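/- **Setting.** Let $\mathcal A$ be a finite subset of a real normed space, $q\ge 0$, $\mathcal I=\{0,\dots,q\}$, and let $p(a,i)$, $(a,i)\in\mathcal A\times\mathcal I$, be a zero-mean Gaussian process with covariance kernel $k$; write $f=p(\cdot,0)$ (performance) and $g_i=p(\cdot,i)$ for $i\ge 1$ (constraints). Evaluating a parameter $a$ returns $p(a,i)+\omega_i$ for every $i\in\mathcal I$, where all noise variables, over all evaluations and all $i$, are independent $\mathcal N(0,\sigma^2)$, $\sigma^2>0$, and independent of $p$. Let $L\ge 0$, let $\emptyset\ne S_0\subseteq\mathcal A$, and let $\{1,\dots,q\}\subseteq J\subseteq\mathcal I$ be the set of indices $i$ for which $p(\cdot,i)\ge 0$ on $S_0$ is presupposed. Let $\delta\in(0,1)$, $\beta_n=2\log(|\mathcal I|\,|\mathcal A|\,\pi_n/\delta)$ with $\pi_n>0$ and $\sum_{n\ge1}\pi_n^{-1}=1$. **Algorithm (SafeOpt-MC).** Let $\mu_{n}$ and $\sigma_{n}$ be the GP posterior mean and standard deviation of $p$ given the $|\mathcal I|n$ measurements at $a_1,\dots,a_n$. Put $C_0(a,i)=[0,\infty)$ if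 $a\in S_0$ and $i\in J$, $C_0(a,i)=\mathbb R$ otherwise, and for $n\ge1$ $$C_n(a,i)=C_{n-1}(a,i)\cap\big[\mu_{n-1}(a,i)\pm\beta_n^{1/2}\sigma_{n-1}(a,i)\big],\quad l_n^i(a)=\min C_n(a,i),\quad u_n^i(a)=\max C_n(a,i),$$ $$S_n=\bigcap_{i\ge1}\bigcup_{a\in S_{n-1}}\{a'\in\mathcal A: l_n^i(a)-L\|a-a'\|\ge0\},\qquad M_n=\{a\in S_n:u_n^0(a)\ge\max_{a'\in S_n}l_n^0(a')\},$$ $$e_n(a)=\big|\{a'\in\mathcal A\setminus S_n:\exists i\ge1,\ u_n^i(a)-L\|a-a'\|\ge0\}\big|,\qquad G_n=\{a\in S_n:e_n(a)\ge\theta\},$$ with fixed $\theta\in\{0,1\}$ (for $\theta=1$, $G_n$ consists of the points that could enlarge $S_n$; for $\theta=0$, $G_n=S_n$). Iteration $n$ evaluates some $a_n\in G_n\cup M_n$ such that, for some $i\in\mathcal I$, $(a_n,i)$ maximizes $u_n^i(a)-l_n^i(a)$ over $(G_n\cup M_n)\times\mathcal I$; ties are broken by means of the past measurements and, possibly, randomness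 independent of $p$ and of the noise. The pessimistic estimate $\hat a_n$ is any maximizer of $l_n^0$ over $S_n$. **Baseline.** $R_\epsilon(S)=S\cup\bigcap_{i\ge1}\{a\in\mathcal A:\exists a'\in S,\ g_i(a')-\epsilon-L\|a-a'\|\ge0\}$, $\bar R_\epsilon(S_0)=\bigcup_n R_\epsilon^n(S_0)$, $f^*_\epsilon=\max_{\bar R_\epsilon(S_0)}f$. Let $\gamma_n$ be the maximum, over all sequences of $n$ inputs in $\mathcal A\times\mathcal I$ (repetitions allowed), of the mutual information between $p$ and the $n$ noisy observations of $p$ at these inputs with noise variance $\sigma^2$; let $C_1=8/\log(1+\sigma^{-2})$. **Theorem.** For every $\epsilon\ge0$ there is an event of probability at least $1-\delta$ on which the following holds: if $p(\cdot,i)$ is $L$-Lipschitz for every $i\in\mathcal I$ and $p(a,i)\ge0$ for all $a\in S_0$, $i\in J$, then 1. $g_i(a_n)\ge0$ for all $n\ge1$ and all $i=1,\dots,q$; 2. if moreover $k((a,i),(a,i))\le1$ for all $(a,i)$ and $\pi_n$ is nondecreasing in $n$, then for the smallest positive integer $n^*$ with $$\frac{n^*}{\beta_{n^*}\gamma_{|\mathcal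 I|n^*}}\ \ge\ \frac{C_1\,(|\bar R_0(S_0)|+1)}{\epsilon^2},$$ provided that such an integer exists, $f(\hat a_n)\ge f^*_\epsilon-\epsilon$ for all $n\ge n^*$. (A quotient of a positive number by $0$ is read as $+\infty$.) -/

import Mathlib

open MeasureTheory ProbabilityTheory
open scoped NNReal ENNReal Matrix

noncomputable section

namespace SafeOptMC

/-! ### Gaussian process regression -/

section Posterior

variable {X ι : Type*} [Fintype ι] [DecidableEq ι]

/-- The regularized covariance matrix `K + v I` of noisy observations at the inputs `x j`. -/
def regGram (k : X → X → ℝ) (v : ℝ) (x : ι → X) : Matrix ι ι ℝ :=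
  Matrix.of (fun j j' => k (x j) (x j')) + v • (1 : Matrix ι ι ℝ)

/-- Posterior mean at `z` of the zero-mean GP with kernel `k`, given the values `y j` observed
at the inputs `x j` with noise variance `v`. -/
def postMean (k : X → X → ℝ) (v : ℝ) (x : ι → X) (y : ι → ℝ) (z : X) : ℝ :=
  (fun j => k z (x j)) ⬝ᵥ ((regGram k v x)⁻¹ *ᵥ y)

/-- Posterior variance at `z`. -/
def postVar (k : X → X → ℝ) (v : ℝ) (x : ι → X) (z : X) : ℝ :=
  k z z - (fun j => k z (x j)) ⬝ᵥ ((regGram k v x)⁻¹ *ᵥ (fun j => k z (x j)))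

end Posterior

/-! ### Information gain -/

section Information

variable {X : Type*}

/-- Mutual information of the two coordinates under a joint law `ρ`. -/
def mutualInfo {Y Z : Type*} [MeasurableSpace Y] [MeasurableSpace Z]
    (ρ : Measure (Y × Z)) : ℝ≥0∞ :=
  InformationTheory.klDiv ρ (ρ.fst.prod ρ.snd)

/-- Joint law of a random function with law `ν` and of its values at the inputs
`x 0, …, x (n-1)` observed with independent centred Gaussian noise of variance `v`. -/
def obsLaw (ν : Measure (X → ℝ)) (v : ℝ≥0) {n : ℕ} (x : Fin n → X) :
    Measure ((X → ℝ) × (Fin n → ℝ)) :=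
  (ν.prod (Measure.pi fun _ : Fin n => gaussianReal 0 v)).map
    (fun z => (z.1, fun m => z.1 (x m) + z.2 m))

/-- The information gain `γ_n`: the maximal mutual information between the random function and
`n` noisy observations of it. -/
def infoGain (ν : Measure (X → ℝ)) (v : ℝ≥0) (n : ℕ) : ℝ≥0∞ :=
  ⨆ x : Fin n → X, mutualInfo (obsLaw ν v x)

end Information

/-! ### The reachable set -/

section Reachable

variable {E : Type*} [NormedAddCommGroup E] {A : Finset E} {q : ℕ}

/-- The one-step expansion operator `R_ε`, for the surrogate function `p`
(`p (a, 0)` is the performance, `p (a, i)` with `i ≠ 0` are the constraints). -/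
def reach (L : ℝ≥0) (p : A × Fin (q + 1) → ℝ) (ε : ℝ) (S : Set A) : Set A :=
  S ∪ {a | ∀ i : Fin (q + 1), i ≠ 0 →
    ∃ a' ∈ S, 0 ≤ p (a', i) - ε - L * ‖(a : E) - (a' : E)‖}

/-- The limit of the increasing sequence of iterates of `R_ε`. -/
def reachLim (L : ℝ≥0) (p : A × Fin (q + 1) → ℝ) (ε : ℝ) (S : Set A) : Set A :=
  ⋃ n : ℕ, (reach L p ε)^[n] S

/-- The best performance over the reachable set. -/
def fStar (L : ℝ≥0) (p : A × Fin (q + 1) → ℝ) (ε : ℝ) (S : Set A) : ℝ :=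
  sSup ((fun a => p (a, 0)) '' reachLim L p ε S)

end Reachable

/-! ### The algorithm -/

/-- The inputs of the algorithm. No relation between them is imposed here. -/
structure Input {E : Type*} [NormedAddCommGroup E] (A : Finset E) (q : ℕ) where
  /-- GP kernel on the extended parameter space. -/
  k : A × Fin (q + 1) → A × Fin (q + 1) → ℝ
  /-- Noise variance. -/
  v : ℝ≥0
  /-- Confidence parameters `β_n`, `n ≥ 1`. -/
  β : ℕ → ℝ
  /-- Lipschitz constant. -/
  L : ℝ≥0
  /-- Initial safe set. -/
  S₀ : Set A
  /-- Indices of the functions which are known to be nonnegative on the initial safe set. -/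
  J : Set (Fin (q + 1))
  /-- Number of points that an expander has to be able to add optimistically. -/
  θ : ℕ

namespace Input

variable {E : Type*} [NormedAddCommGroup E] {A : Finset E} {q : ℕ} (I : Input A q)
  (a : ℕ → A) (y : ℕ → Fin (q + 1) → ℝ)

/-! Below, `a m` and `y m i` are the parameter evaluated in iteration `m + 1` and the values
measured there. All sets and bounds with index `n` are those of iteration `n`. -/

/-- Inputs of the measurements of the first `n` iterations. -/
def design (n : ℕ) : Fin n × Fin (q + 1) → A × Fin (q + 1) :=
  fun j => (a j.1, j.2)

/-- `μ_n`: posterior mean after `n` iterations. -/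
def μ (n : ℕ) (z : A × Fin (q + 1)) : ℝ :=
  postMean I.k I.v (design a n) (fun j => y j.1 j.2) z

/-- `σ_n`: posterior standard deviation after `n` iterations. -/
def σ (n : ℕ) (z : A × Fin (q + 1)) : ℝ :=
  √(postVar I.k I.v (design a n) z)

open Classical in
/-- The nested confidence sets `C_n`. -/
def C : ℕ → A × Fin (q + 1) → Set ℝ
  | 0, z => if z.1 ∈ I.S₀ ∧ z.2 ∈ I.J then Set.Ici 0 else Set.univ
  | n + 1, z => C n z ∩
      Set.Icc (I.μ a y n z - √(I.β (n + 1)) * I.σ a n z)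
        (I.μ a y n z + √(I.β (n + 1)) * I.σ a n z)

/-- Lower confidence bound `l_n` (for `n ≥ 1`). -/
def l (n : ℕ) (z : A × Fin (q + 1)) : ℝ := sInf (I.C a y n z)

/-- Upper confidence bound `u_n` (for `n ≥ 1`). -/
def u (n : ℕ) (z : A × Fin (q + 1)) : ℝ := sSup (I.C a y n z)

/-- Width `w_n` of the confidence set. -/
def w (n : ℕ) (z : A × Fin (q + 1)) : ℝ := I.u a y n z - I.l a y n z

/-- The safe sets `S_n`. -/
def S : ℕ → Set A
  | 0 => I.S₀
  | n + 1 => {b | ∀ i : Fin (q + 1), i ≠ 0 →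
      ∃ c ∈ S n, 0 ≤ I.l a y (n + 1) (c, i) - I.L * ‖(c : E) - (b : E)‖}

/-- The maximizers `M_n`. -/
def M (n : ℕ) : Set A :=
  {b | b ∈ I.S a y n ∧ ∀ c ∈ I.S a y n, I.l a y n (c, 0) ≤ I.u a y n (b, 0)}

/-- `e_n`: the number of parameters outside `S_n` that could be classified as safe. -/
def e (n : ℕ) (b : A) : ℕ :=
  Set.ncard {c : A | c ∉ I.S a y n ∧
    ∃ i : Fin (q + 1), i ≠ 0 ∧ 0 ≤ I.u a y n (b, i) - I.L * ‖(b : E) - (c : E)‖}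

/-- The expanders `G_n`. -/
def G (n : ℕ) : Set A := {b | b ∈ I.S a y n ∧ I.θ ≤ I.e a y n b}

/-- The parameters that the acquisition rule may select in iteration `n`: those `b` for which
some pair `(b, i)` maximizes `w_n` over `(G_n ∪ M_n) × {0, …, q}`. -/
def acquisition (n : ℕ) : Set A :=
  {b | b ∈ I.G a y n ∪ I.M a y n ∧ ∃ i : Fin (q + 1),
    ∀ c ∈ I.G a y n ∪ I.M a y n, ∀ j : Fin (q + 1), I.w a y n (c, j) ≤ I.w a y n (b, i)}

/-- The maximizers of `l_n(·, 0)` over `S_n`. -/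
def bestEstimates (n : ℕ) : Set A :=
  {b | b ∈ I.S a y n ∧ ∀ c ∈ I.S a y n, I.l a y n (c, 0) ≤ I.l a y n (b, 0)}

end Input

/-- The measurement of the `i`-th function in iteration `m + 1`. -/
def meas {Ω α ι : Type*} (p : α × ι → Ω → ℝ) (noise : ℕ → ι → Ω → ℝ) (a : ℕ → Ω → α)
    (ω : Ω) (m : ℕ) (i : ι) : ℝ :=
  p (a m ω, i) ω + noise m i ω

/-- The σ-algebra generated by the measurements of the first `n` iterations. -/
@[reducible] def history {Ω α ι : Type*} (p : α × ι → Ω → ℝ) (noise : ℕ → ι → Ω → ℝ) (a : ℕ → Ω → α)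
    (n : ℕ) : MeasurableSpace Ω :=
  ⨆ m : ℕ, ⨆ _ : m < n, ⨆ i : ι,
    MeasurableSpace.comap (fun ω => meas p noise a ω m i) inferInstance

end SafeOptMC

end

/-! Probability enters only through the event that every value of `p` lies in every confidence
interval; on it the claims are deterministic.

The obstacle to bounding that event is that the design depends on the data. For a fixed design, the
error of the posterior mean is a centred Gaussian whose variance is the posterior variance, and it
is independent of the measurements (`residual_law_and_indep`). Whether the run follows that design
is decided by those measurements and the external randomness (`measurableSet_design`), so
restricting to this event costs only its probability as a factor. Summing over the finitely many
designs gives the nonadaptive tail bound (`measure_confidence_compl_le`), and the choice of `β`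
makes the union bound sum to `δ`.

On the event `WellCalibrated`, safety follows from valid lower bounds and the Lipschitz condition.
For optimality, let `D` be the size of the limit of `R_0`. The safe sets increase inside that limit,
so they grow fewer than `D` times after iteration 1. Squared widths are at most `4 β` times
posterior variances, and the sum of the latter is controlled by the information gain
(`sum_log_le_infoGain`). Hence some iteration combines a stalled safe set with a maximal width at
most `ε` (`exists_stall`). There the safe set is closed under `R_ε`, so it contains the optimum, and
the lower bounds are within `ε` of it (`fStar_sub_le`). If the budget is at most `D`, counting says
nothing, but the threshold then forces `|p| ≤ ε / 2` everywhere.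

The information gain is only needed as an upper bound for log-determinants, so half of the
Donsker–Varadhan formula with one well-chosen test function suffices (`log_det_le_mutualInfo`). -/

/-! ### Determinants of regularized positive semidefinite matrices -/

namespace Matrix.IsHermitian

variable {ι : Type*} [Fintype ι] [DecidableEq ι]

lemma det_add_smul_one {Q : Matrix ι ι ℝ} (hQ : Q.IsHermitian) (v : ℝ) :
    (Q + v • (1 : Matrix ι ι ℝ)).det = ∏ j, (hQ.eigenvalues j + v) := by
  have h := congrArg (Polynomial.eval (-v)) hQ.charpoly_eq
  rw [Matrix.eval_charpoly, Polynomial.eval_prod] at h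
  have h1 : Matrix.scalar ι (-v) - Q = -(Q + v • (1 : Matrix ι ι ℝ)) := by
    rw [Matrix.scalar_apply, ← Matrix.smul_one_eq_diagonal]
    simp [sub_eq_add_neg, add_comm]
  rw [h1, Matrix.det_neg] at h
  have h2 : ∏ j, (hQ.eigenvalues j + v) =
      (-1) ^ Fintype.card ι * ∏ j, (-v - hQ.eigenvalues j) := by
    rw [Fintype.card, ← Finset.prod_const, ← Finset.prod_mul_distrib]
    exact Finset.prod_congr rfl fun j _ => by ring
  simp only [Polynomial.eval_sub, Polynomial.eval_X, Polynomial.eval_C, RCLike.ofReal_real_eq_id,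
    id_eq] at h
  rw [h2, ← h, ← mul_assoc, ← mul_pow]
  simp

end Matrix.IsHermitian

lemma Finset.one_add_sum_le_prod_of_nonneg {ι : Type*} (s : Finset ι) (f : ι → ℝ)
    (hf : ∀ i ∈ s, 0 ≤ f i) : 1 + ∑ i ∈ s, f i ≤ ∏ i ∈ s, (1 + f i) := by
  classical
  induction s using Finset.induction_on with
  | empty => simp
  | insert a s ha ih =>
    rw [Finset.sum_insert ha, Finset.prod_insert ha]
    have h1 := ih fun i hi => hf i (Finset.mem_insert_of_mem hi)
    have h2 := hf a (Finset.mem_insert_self a s)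
    have h3 : 0 ≤ ∑ i ∈ s, f i := Finset.sum_nonneg fun i hi => hf i (Finset.mem_insert_of_mem hi)
    nlinarith

/-- Expanding the product of `1 + eigenvalue / v` leaves at least one plus the trace over `v`, and
the trace dominates each diagonal entry. -/
lemma Matrix.PosSemidef.one_add_le_det {ι : Type*} [Fintype ι] [DecidableEq ι]
    {Q : Matrix ι ι ℝ} (hQ : Q.PosSemidef) {v : ℝ} (hv : 0 < v) (i : ι) :
    v ^ Fintype.card ι * (1 + Q i i / v) ≤ (Q + v • (1 : Matrix ι ι ℝ)).det := by
  rw [hQ.1.det_add_smul_one]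
  have h1 : ∏ j, (hQ.1.eigenvalues j + v) =
      v ^ Fintype.card ι * ∏ j, (1 + hQ.1.eigenvalues j / v) := by
    rw [Fintype.card, ← Finset.prod_const, ← Finset.prod_mul_distrib]
    exact Finset.prod_congr rfl fun j _ => by field_simp; ring
  rw [h1]
  have h2 : Q i i ≤ ∑ j, hQ.1.eigenvalues j := by
    have := hQ.1.trace_eq_sum_eigenvalues
    simp only [RCLike.ofReal_real_eq_id, id_eq] at this
    rw [← this, Matrix.trace]
    exact Finset.single_le_sum (f := fun j => Q j j) (fun j _ => hQ.diag_nonneg)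
      (Finset.mem_univ i)
  have h3 := Finset.one_add_sum_le_prod_of_nonneg Finset.univ (fun j => hQ.1.eigenvalues j / v)
    fun j _ => div_nonneg (hQ.eigenvalues_nonneg j) hv.le
  rw [← Finset.sum_div] at h3
  gcongr
  exact le_trans (by gcongr) h3

namespace SafeOptMC

/-! ### Posterior covariances as Schur complements -/

section Posterior

variable {X ι κ : Type*} [Fintype ι] [DecidableEq ι] [Fintype κ] [DecidableEq κ]
  {k : X → X → ℝ} {v : ℝ}

lemma posSemidef_gram (hk : (Matrix.of k).PosSemidef) {ι : Type*} (x : ι → X) :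
    (Matrix.of fun j j' => k (x j) (x j')).PosSemidef := hk.submatrix x

lemma kernel_symm (hk : (Matrix.of k).PosSemidef) (z z' : X) : k z z' = k z' z := by
  simpa using (hk.1.apply z z').symm

omit [Fintype ι] in
lemma posDef_regGram (hk : (Matrix.of k).PosSemidef) (hv : 0 < v) (x : ι → X) :
    (regGram k v x).PosDef :=
  Matrix.PosDef.posSemidef_add (posSemidef_gram hk x) (Matrix.PosDef.one.smul hv)

/-- Posterior covariance matrix of the process at the points `z c`. -/
noncomputable def postCov (k : X → X → ℝ) (v : ℝ) (x : ι → X) (z : κ → X) : Matrix κ κ ℝ :=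
  Matrix.of (fun c c' => k (z c) (z c')) -
    (Matrix.of fun j c => k (x j) (z c))ᴴ * (regGram k v x)⁻¹ *
      (Matrix.of fun j c => k (x j) (z c))

omit [Fintype κ] [DecidableEq κ] in
lemma postCov_diag (hk : (Matrix.of k).PosSemidef) (x : ι → X) (z : κ → X) (c : κ) :
    postCov k v x z c c = postVar k v x (z c) := by
  rw [postCov, postVar, Matrix.mul_assoc, Matrix.sub_apply, Matrix.mul_apply]
  simp only [Matrix.of_apply, dotProduct, Matrix.conjTranspose_apply, star_trivial,
    Matrix.mul_apply, Matrix.mulVec, kernel_symm hk (z c)]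

omit [Fintype ι] [Fintype κ] in
lemma regGram_sum (hk : (Matrix.of k).PosSemidef) (x : ι → X) (z : κ → X) :
    regGram k v (Sum.elim x z) = Matrix.fromBlocks (regGram k v x)
      (Matrix.of fun j c => k (x j) (z c)) (Matrix.of fun j c => k (x j) (z c))ᴴ
      (regGram k v z) := by
  ext i j
  rcases i with i | i <;> rcases j with j | j <;> simp [regGram, Matrix.one_apply]
  exact kernel_symm hk _ _

/-- It is the Schur complement of a joint Gram matrix with noise `v` added on the observed block
only, which is still positive semidefinite. -/
lemma postCov_posSemidef (hk : (Matrix.of k).PosSemidef) (hv : 0 < v) (x : ι → X) (z : κ → X) :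
    (postCov k v x z).PosSemidef := by
  have hA := posDef_regGram hk hv x
  have : Invertible (regGram k v x) := hA.isUnit.invertible
  refine (Matrix.PosDef.fromBlocks₁₁ (Matrix.of fun j c => k (x j) (z c))
    (Matrix.of fun c c' => k (z c) (z c')) hA).1 ?_
  have h1 := posSemidef_gram hk (Sum.elim x z)
  have h2 : (Matrix.diagonal (Sum.elim (fun _ : ι => v) fun _ : κ => 0)).PosSemidef := by
    refine Matrix.PosSemidef.diagonal fun i => ?_
    rcases i with i | i <;> simp [hv.le]
  refine (congrArg Matrix.PosSemidef ?_).mpr (h1.add h2)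
  ext i j
  rcases i with i | i <;> rcases j with j | j <;>
    simp [regGram, Matrix.one_apply, Matrix.diagonal_apply]
  exact kernel_symm hk _ _

/-- The chain rule for information in determinant form, from the Schur complement of the observed
block. -/
lemma det_regGram_sum (hk : (Matrix.of k).PosSemidef) (hv : 0 < v) (x : ι → X) (z : κ → X) :
    (regGram k v (Sum.elim x z)).det =
      (regGram k v x).det * (postCov k v x z + v • (1 : Matrix κ κ ℝ)).det := by
  have : Invertible (regGram k v x) := (posDef_regGram hk hv x).isUnit.invertible
  rw [regGram_sum hk, Matrix.det_fromBlocks₁₁, Matrix.invOf_eq_nonsing_inv, postCov, regGram,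
    regGram]
  congr 2
  abel

lemma postVar_nonneg (hk : (Matrix.of k).PosSemidef) (hv : 0 < v) (x : ι → X) (z : X) :
    0 ≤ postVar k v x z := by
  rw [← postCov_diag hk x (fun _ : Unit => z) ()]
  exact (postCov_posSemidef hk hv x _).diag_nonneg

lemma postVar_le (hk : (Matrix.of k).PosSemidef) (hv : 0 < v) (x : ι → X) (z : X) :
    postVar k v x z ≤ k z z := by
  have h := (posDef_regGram hk hv x).inv.posSemidef.dotProduct_mulVec_nonneg
    (fun j => k z (x j))
  rw [star_trivial] at h
  rw [postVar]
  linarith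

omit [Fintype ι] [Fintype κ] in
lemma regGram_comp_equiv (x : ι → X) (f : κ ≃ ι) :
    regGram k v (x ∘ f) = (regGram k v x).submatrix f f := by
  ext i j
  simp [regGram, Matrix.one_apply]

lemma det_regGram_comp_equiv (x : ι → X) (f : κ ≃ ι) :
    (regGram k v (x ∘ f)).det = (regGram k v x).det := by
  rw [regGram_comp_equiv, Matrix.det_submatrix_equiv_self]

lemma postVar_of_isEmpty [IsEmpty ι] (x : ι → X) (z : X) : postVar k v x z = k z z := by
  simp [postVar]

end Posterior

/-! ### Information collected by successive batches -/

section Design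

variable {α : Type*} {κ : Type*} [Fintype κ] [DecidableEq κ]
  {k : α × κ → α × κ → ℝ} {v : ℝ}

/-- Each batch of measurements that contains the input `(a t, i t)` gains at least the information
provided by that input. -/
lemma sum_log_le_log_det (hk : (Matrix.of k).PosSemidef) (hv : 0 < v) (a : ℕ → α) (i : ℕ → κ)
    (n : ℕ) :
    ∑ t ∈ Finset.range n,
        Real.log (1 + postVar k v (fun j : Fin t × κ => (a j.1, j.2)) (a t, i t) / v) ≤
      Real.log ((regGram k v (fun j : Fin n × κ => (a j.1, j.2))).det /
        v ^ Fintype.card (Fin n × κ)) := by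
  induction n with
  | zero => simp
  | succ n ih =>
    rw [Finset.sum_range_succ]
    set x : Fin n × κ → α × κ := fun j => (a j.1, j.2)
    -- Separates the last batch from the earlier ones, so that the determinant factors.
    set f : (Fin n × κ) ⊕ κ ≃ Fin (n + 1) × κ :=
      (((finSuccEquivLast.trans (Equiv.optionEquivSumPUnit.{0} _)).prodCongr (Equiv.refl κ)).trans
        ((Equiv.sumProdDistrib _ _ _).trans
          (Equiv.sumCongr (Equiv.refl _) (Equiv.punitProd κ)))).symm
    have hf : (fun j : Fin (n + 1) × κ => (a j.1, j.2)) ∘ f =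
        Sum.elim x (fun c => (a n, c)) := by
      funext j
      rcases j with j | j <;> simp [f, x]
    rw [← det_regGram_comp_equiv _ f, hf, det_regGram_sum hk hv]
    have h1 := (postCov_posSemidef hk hv x fun c => (a n, c)).one_add_le_det hv (i n)
    rw [postCov_diag hk] at h1
    have h2 := (posDef_regGram hk hv x).det_pos
    have h3 : 0 ≤ postVar k v x (a n, i n) / v := div_nonneg (postVar_nonneg hk hv _ _) hv.le
    have h4 : Fintype.card (Fin (n + 1) × κ) =
        Fintype.card (Fin n × κ) + Fintype.card κ := by
      simp [add_mul]
    calc _ ≤ Real.log ((regGram k v x).det / v ^ Fintype.card (Fin n × κ)) +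
          Real.log (1 + postVar k v x (a n, i n) / v) := by gcongr
      _ = Real.log ((regGram k v x).det / v ^ Fintype.card (Fin n × κ) *
            (1 + postVar k v x (a n, i n) / v)) := by
          rw [Real.log_mul (by positivity) (by positivity)]
      _ ≤ _ := by
          apply Real.log_le_log (by positivity)
          rw [h4, pow_add, div_mul_eq_mul_div, mul_div_mul_comm, div_mul_eq_mul_div]
          gcongr
          rw [le_div_iff₀ (by positivity)]
          linarith

end Design

end SafeOptMC

/-! ### Mutual information of Gaussian observations -/

namespace Matrix.IsHermitian

variable {ι : Type*} [Fintype ι] [DecidableEq ι] {K : Matrix ι ι ℝ} (hK : K.IsHermitian)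
include hK

lemma sum_eigenvector_mul (j j' : ι) :
    ∑ m, hK.eigenvectorBasis j m * hK.eigenvectorBasis j' m = if j = j' then 1 else 0 := by
  rw [← orthonormal_iff_ite.1 hK.eigenvectorBasis.orthonormal j j']
  simp [PiLp.inner_apply, mul_comm]

lemma sum_eigenvector_mul_mul (j j' : ι) :
    ∑ m, ∑ m', hK.eigenvectorBasis j m * (hK.eigenvectorBasis j' m' * K m m') =
      if j = j' then hK.eigenvalues j else 0 := by
  have h : ∀ m, ∑ m', hK.eigenvectorBasis j m * (hK.eigenvectorBasis j' m' * K m m') =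
      hK.eigenvalues j' * (hK.eigenvectorBasis j m * hK.eigenvectorBasis j' m) := fun m => by
    have := congrFun (hK.mulVec_eigenvectorBasis j') m
    simp only [Matrix.mulVec, dotProduct, Pi.smul_apply, smul_eq_mul] at this
    rw [← Finset.mul_sum, mul_left_comm, ← this]
    simp_rw [mul_comm]
  simp_rw [h, ← Finset.mul_sum, hK.sum_eigenvector_mul]
  split_ifs with hj
  · rw [hj, mul_one]
  · rw [mul_zero]

end Matrix.IsHermitian

namespace SafeOptMC

/-- One half of the Donsker–Varadhan variational formula. -/
lemma ofReal_integral_le_klDiv {α : Type*} [MeasurableSpace α] {μ ν : Measure α}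
    [IsProbabilityMeasure μ] [IsProbabilityMeasure ν] {h : α → ℝ} (hm : Measurable h)
    (hint : Integrable h μ) (hexp : ∫⁻ x, ENNReal.ofReal (Real.exp (h x)) ∂ν ≤ 1) :
    ENNReal.ofReal (∫ x, h x ∂μ) ≤ InformationTheory.klDiv μ ν := by
  by_cases htop : InformationTheory.klDiv μ ν = ∞
  · simp [htop]
  obtain ⟨hac, hllr⟩ := InformationTheory.klDiv_ne_top_iff.1 htop
  rw [InformationTheory.klDiv_of_ac_of_integrable hac hllr]
  simp only [probReal_univ, add_sub_cancel_right]
  apply ENNReal.ofReal_le_ofReal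
  have hgm : Measurable fun x => Real.exp (h x - llr μ ν x) :=
    (hm.sub (measurable_llr μ ν)).exp
  have hle : ∫⁻ x, ENNReal.ofReal (Real.exp (h x - llr μ ν x)) ∂μ ≤ 1 := by
    rw [← lintegral_rnDeriv_mul hac hgm.ennreal_ofReal.aemeasurable]
    refine le_trans (lintegral_mono_ae ?_) hexp
    filter_upwards [μ.rnDeriv_lt_top ν] with x hx
    rcases eq_or_ne (μ.rnDeriv ν x) 0 with h0 | h0
    · simp [h0]
    · have hpos : 0 < (μ.rnDeriv ν x).toReal := ENNReal.toReal_pos h0 hx.ne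
      rw [llr, Real.exp_sub, Real.exp_log hpos, ← ENNReal.ofReal_toReal hx.ne,
        ENNReal.toReal_ofReal hpos.le, ← ENNReal.ofReal_mul hpos.le, mul_div_cancel₀ _ hpos.ne']
  have hgi : Integrable (fun x => Real.exp (h x - llr μ ν x)) μ := by
    refine ⟨hgm.aestronglyMeasurable, ?_⟩
    rw [hasFiniteIntegral_iff_ofReal (.of_forall fun x => (Real.exp_pos _).le)]
    exact hle.trans_lt ENNReal.one_lt_top
  have h1 : ∫ x, Real.exp (h x - llr μ ν x) ∂μ ≤ 1 := by
    rw [integral_eq_lintegral_of_nonneg_ae (.of_forall fun x => (Real.exp_pos _).le)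
      hgm.aestronglyMeasurable]
    exact ENNReal.toReal_le_of_le_ofReal zero_le_one (by simpa using hle)
  -- The inequality `x + 1 ≤ exp x` replaces Jensen's inequality.
  have h2 : ∫ x, (h x - llr μ ν x) ∂μ ≤ ∫ x, (Real.exp (h x - llr μ ν x) - 1) ∂μ :=
    integral_mono (hint.sub hllr) (hgi.sub (integrable_const 1)) fun x => by
      have := Real.add_one_le_exp (h x - llr μ ν x)
      simp only
      linarith
  rw [integral_sub hint hllr, integral_sub hgi (integrable_const 1)] at h2
  simp only [integral_const, probReal_univ, smul_eq_mul, mul_one] at h2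
  linarith

/-- Completing the square turns the integrand into a multiple of another Gaussian density. The
degenerate case `s = 0` is needed because the Gram matrix may have zero eigenvalues. -/
lemma lintegral_exp_neg_sq_gaussianReal (c : ℝ) (s : ℝ≥0) {v : ℝ} (hv : 0 < v) :
    ∫⁻ x, ENNReal.ofReal (Real.exp (-(c - x) ^ 2 / (2 * v))) ∂(gaussianReal 0 s) =
      ENNReal.ofReal (√(v / (s + v)) * Real.exp (-c ^ 2 / (2 * (s + v)))) := by
  rcases eq_or_ne s 0 with rfl | hs
  · rw [gaussianReal_zero_var, lintegral_dirac' _ (by fun_prop)]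
    simp [hv.ne']
  have hs0 : 0 < (s : ℝ) := by positivity
  set t : ℝ≥0 := ⟨s * v / (s + v), by positivity⟩ with ht
  have htv : (t : ℝ) = s * v / (s + v) := rfl
  have ht0 : t ≠ 0 := by
    rw [← NNReal.coe_ne_zero, htv]
    positivity
  rw [gaussianReal_of_var_ne_zero _ hs, lintegral_withDensity_eq_lintegral_mul _
    (measurable_gaussianPDF _ _) (by fun_prop)]
  have hpt : ∀ x, (gaussianPDF 0 s * fun x => ENNReal.ofReal
      (Real.exp (-(c - x) ^ 2 / (2 * v)))) x =
      ENNReal.ofReal (√(v / (s + v)) * Real.exp (-c ^ 2 / (2 * (s + v)))) *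
        gaussianPDF (c * s / (s + v)) t x := fun x => by
    simp only [Pi.mul_apply, gaussianPDF]
    rw [← ENNReal.ofReal_mul (gaussianPDFReal_nonneg _ _ _), ← ENNReal.ofReal_mul (by positivity)]
    congr 1
    simp only [gaussianPDFReal, htv]
    have hsq : √(v / (s + v)) * (√(2 * Real.pi * (s * v / (s + v))))⁻¹ =
        (√(2 * Real.pi * s))⁻¹ := by
      rw [← Real.sqrt_inv, ← Real.sqrt_inv, ← Real.sqrt_mul (by positivity)]
      congr 1
      field_simp
    have hex : Real.exp (-c ^ 2 / (2 * (s + v))) *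
        Real.exp (-(x - c * s / (s + v)) ^ 2 / (2 * (s * v / (s + v)))) =
        Real.exp (-(x - 0) ^ 2 / (2 * s)) * Real.exp (-(c - x) ^ 2 / (2 * v)) := by
      rw [← Real.exp_add, ← Real.exp_add]
      congr 1
      field_simp
      ring
    rw [mul_assoc, ← hex, ← hsq]
    ring
  simp_rw [hpt]
  rw [lintegral_const_mul _ (measurable_gaussianPDF _ _), lintegral_gaussianPDF_eq_one _ ht0,
    mul_one]

end SafeOptMC

namespace SafeOptMC

section PiGaussian

variable {ι : Type*} [Fintype ι] (v : ℝ≥0) (c : ι → ℝ)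

lemma memLp_sum_mul_pi_gaussianReal :
    MemLp (fun z : ι → ℝ => ∑ m, c m * z m) 2 (Measure.pi fun _ : ι => gaussianReal 0 v) := by
  refine memLp_finsetSum _ fun m _ => MemLp.const_mul ?_ _
  exact (memLp_id_gaussianReal' 2 (by simp)).comp_measurePreserving
    (measurePreserving_eval (fun _ : ι => gaussianReal 0 v) m)

lemma integral_sum_mul_pi_gaussianReal :
    ∫ z : ι → ℝ, ∑ m, c m * z m ∂(Measure.pi fun _ : ι => gaussianReal 0 v) = 0 := by
  rw [integral_finsetSum]
  · refine Finset.sum_eq_zero fun m _ => ?_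
    rw [integral_const_mul]
    have := integral_comp_eval (μ := fun _ : ι => gaussianReal 0 v) (i := m)
      (f := fun x : ℝ => x) aestronglyMeasurable_id
    rw [this, integral_id_gaussianReal, mul_zero]
  · intro m _
    exact (((memLp_id_gaussianReal' 2 (by simp)).comp_measurePreserving
      (measurePreserving_eval (fun _ : ι => gaussianReal 0 v) m)).integrable (by simp)).const_mul _

lemma integral_sum_mul_sq_pi_gaussianReal :
    ∫ z : ι → ℝ, (∑ m, c m * z m) ^ 2 ∂(Measure.pi fun _ : ι => gaussianReal 0 v) =
      v * ∑ m, c m ^ 2 := by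
  rw [← variance_of_integral_eq_zero (memLp_sum_mul_pi_gaussianReal v c).aemeasurable
    (integral_sum_mul_pi_gaussianReal v c)]
  have h := variance_sum_pi (μ := fun _ : ι => gaussianReal 0 v) (X := fun m x => c m * x)
    fun m => (memLp_id_gaussianReal' 2 (by simp)).const_mul _
  have h' : (∑ m, fun z : ι → ℝ => c m * z m) = fun z => ∑ m, c m * z m := by
    ext z
    simp
  rw [h'] at h
  rw [h, Finset.mul_sum]
  refine Finset.sum_congr rfl fun m _ => ?_
  rw [variance_const_mul, variance_fun_id_gaussianReal, mul_comm]

end PiGaussian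

/-- The mutual information between a Gaussian random function and noisy observations of it is at
least `½ log det (I + v⁻¹ K)`. -/
lemma log_det_le_mutualInfo {X : Type*} [Fintype X] (ν : Measure (X → ℝ)) [IsGaussian ν]
    {k : X → X → ℝ} (hk : (Matrix.of k).PosSemidef)
    (hmean : ∀ z, ∫ f, f z ∂ν = 0) (hcov : ∀ z z', cov[fun f => f z, fun f => f z'; ν] = k z z')
    {v : ℝ≥0} (hv : 0 < v) {n : ℕ} (x : Fin n → X) :
    ENNReal.ofReal (Real.log ((regGram k v x).det / (v : ℝ) ^ n) / 2) ≤
      mutualInfo (obsLaw ν v x) := by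
  have hv0 : (0 : ℝ) < v := by exact_mod_cast hv
  have hK : (Matrix.of fun j j' => k (x j) (x j')).PosSemidef := posSemidef_gram hk x
  set O : Fin n → Fin n → ℝ := fun j m => hK.1.eigenvectorBasis j m with hO
  set lam : Fin n → ℝ := hK.1.eigenvalues with hlam
  have hlam0 : ∀ j, 0 ≤ lam j := hK.eigenvalues_nonneg
  set F : Fin n → (X → ℝ) → ℝ := fun j f => ∑ m, O j m * f (x m) with hF
  set Z : Fin n → (Fin n → ℝ) → ℝ := fun j z => ∑ m, O j m * z m with hZ
  set N : Measure (Fin n → ℝ) := Measure.pi fun _ => gaussianReal 0 v with hN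
  have hνeval : HasGaussianLaw (fun f : X → ℝ => f) ν := IsGaussian.hasGaussianLaw_id
  have hL2 : ∀ z, MemLp (fun f : X → ℝ => f z) 2 ν := fun z => (hνeval.eval z).memLp_two
  have hFL2 : ∀ j, MemLp (F j) 2 ν := fun j =>
    memLp_finsetSum _ fun m _ => (hL2 (x m)).const_mul _
  have hFm : ∀ j, Measurable (F j) := fun j => by simp only [hF]; fun_prop
  have hZm : ∀ j, Measurable (Z j) := fun j => by simp only [hZ]; fun_prop
  have hFmean : ∀ j, ∫ f, F j f ∂ν = 0 := fun j => by
    simp only [hF]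
    rw [integral_finsetSum _ fun m _ => ((hL2 (x m)).integrable (by simp)).const_mul _]
    simp [integral_const_mul, hmean]
  have hFcov : ∀ j j', cov[F j, F j'; ν] = if j = j' then lam j else 0 := fun j j' => by
    rw [← hK.1.sum_eigenvector_mul_mul j j']
    simp only [hF]
    rw [covariance_fun_sum_fun_sum (fun m => (hL2 (x m)).const_mul _)
      fun m => (hL2 (x m)).const_mul _]
    simp_rw [covariance_const_mul_left, covariance_const_mul_right, hcov]
    rfl
  have hFvar : ∀ j, Var[F j; ν] = lam j := fun j => by
    rw [← covariance_self (hFm j).aemeasurable, hFcov, if_pos rfl]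
  have hFgauss : HasGaussianLaw (fun f j => F j f) ν := by
    have h := hνeval.map_fun (LinearMap.toContinuousLinearMap
      (LinearMap.pi fun j => ∑ m, O j m • LinearMap.proj (R := ℝ) (φ := fun _ : X => ℝ) (x m)))
    refine (congrArg (HasGaussianLaw · ν) ?_).mpr h
    ext f j
    simp [hF, -LinearMap.coe_toContinuousLinearMap, LinearMap.coe_toContinuousLinearMap']
  -- In the eigenbasis the coordinates are uncorrelated and jointly Gaussian, so the problem splits
  -- into scalar ones.
  have hFind : iIndepFun F ν := hFgauss.iIndepFun_of_covariance_eq_zero fun j j' hjj' => by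
    rw [hFcov, if_neg hjj']
  have hFlaw : ∀ j, ν.map (F j) = gaussianReal 0 (lam j).toNNReal := fun j => by
    rw [(hFgauss.eval j).map_eq_gaussianReal, hFmean, hFvar]
  set T : (X → ℝ) × (Fin n → ℝ) → (X → ℝ) × (Fin n → ℝ) :=
    fun z => (z.1, fun m => z.1 (x m) + z.2 m) with hT
  have hTm : Measurable T := by simp only [hT]; fun_prop
  have hρ : obsLaw ν v x = (ν.prod N).map T := rfl
  have : IsProbabilityMeasure (obsLaw ν v x) := by
    rw [hρ]; exact Measure.isProbabilityMeasure_map hTm.aemeasurable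
  have hfst : (obsLaw ν v x).fst = ν := by
    rw [hρ, Measure.fst, Measure.map_map measurable_fst hTm]
    exact Measure.fst_prod
  -- The log-likelihood ratio between the law of the observations given the function and their
  -- marginal law, in eigencoordinates; this is the optimal test function.
  set h : (X → ℝ) × (Fin n → ℝ) → ℝ := fun z => ∑ j,
    ((Z j z.2) ^ 2 / (2 * (lam j + v)) - (Z j z.2 - F j z.1) ^ 2 / (2 * v)
      + Real.log ((lam j + v) / v) / 2) with hh
  have hhm : Measurable h := by
    refine Finset.measurable_sum _ fun j _ => ?_
    have h1 : Measurable fun z : (X → ℝ) × (Fin n → ℝ) => Z j z.2 := (hZm j).comp measurable_snd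
    have h2 : Measurable fun z : (X → ℝ) × (Fin n → ℝ) => F j z.1 := (hFm j).comp measurable_fst
    fun_prop
  -- the exponential integral
  have hexp : ∫⁻ z, ENNReal.ofReal (Real.exp (h z)) ∂((obsLaw ν v x).fst.prod
      (obsLaw ν v x).snd) ≤ 1 := by
    rw [hfst, lintegral_prod_symm' _ (by fun_prop)]
    -- Integrating out the function gives 1 for each fixed `y`, so the marginal law of the
    -- observations never has to be computed.
    have hinner : ∀ y, ∫⁻ f, ENNReal.ofReal (Real.exp (h (f, y))) ∂ν = 1 := fun y => by
      have hsplit : ∀ f, ENNReal.ofReal (Real.exp (h (f, y))) =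
          ∏ j, ENNReal.ofReal (Real.exp ((Z j y) ^ 2 / (2 * (lam j + v))) *
            √((lam j + v) / v)) *
              ENNReal.ofReal (Real.exp (-(Z j y - F j f) ^ 2 / (2 * v))) := fun f => by
        simp only [hh]
        rw [Real.exp_sum, ENNReal.ofReal_prod_of_nonneg fun _ _ => (Real.exp_pos _).le]
        refine Finset.prod_congr rfl fun j _ => ?_
        rw [← ENNReal.ofReal_mul (by positivity)]
        congr 1
        have hp : 0 < (lam j + v) / v := by have := hlam0 j; positivity
        rw [Real.sqrt_eq_rpow, Real.rpow_def_of_pos hp, ← Real.exp_add, ← Real.exp_add]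
        congr 1
        ring
      simp_rw [hsplit, Finset.prod_mul_distrib]
      rw [lintegral_const_mul _ (Finset.measurable_prod _ fun j _ => by
        have := hFm j; fun_prop)]
      have hind := hFind.comp
        (fun j t => ENNReal.ofReal (Real.exp (-(Z j y - t) ^ 2 / (2 * v)))) fun j => by fun_prop
      have := lintegral_prod_eq_prod_lintegral_of_indepFun Finset.univ _ hind
        fun j => by have := hFm j; simp only [Function.comp_def]; fun_prop
      simp only [Function.comp_apply] at this
      rw [this, ← Finset.prod_mul_distrib]
      refine Finset.prod_eq_one fun j _ => ?_
      have hmap := lintegral_map (μ := ν) (g := F j)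
        (f := fun t => ENNReal.ofReal (Real.exp (-(Z j y - t) ^ 2 / (2 * v)))) (by fun_prop) (hFm j)
      rw [← hmap, hFlaw, lintegral_exp_neg_sq_gaussianReal _ _ hv0,
        Real.coe_toNNReal _ (hlam0 j), ← ENNReal.ofReal_mul (by positivity)]
      have hp : 0 < lam j + v := by have := hlam0 j; positivity
      rw [← ENNReal.ofReal_one]
      congr 1
      have e1 : √((lam j + v) / v) * √(v / (lam j + v)) = 1 := by
        rw [← Real.sqrt_mul (by positivity), div_mul_div_comm, mul_comm, div_self (by positivity),
          Real.sqrt_one]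
      have e2 : Real.exp ((Z j y) ^ 2 / (2 * (lam j + v))) *
          Real.exp (-(Z j y) ^ 2 / (2 * (lam j + v))) = 1 := by
        rw [← Real.exp_add, neg_div, add_neg_cancel, Real.exp_zero]
      calc _ = (√((lam j + v) / v) * √(v / (lam j + v))) *
            (Real.exp ((Z j y) ^ 2 / (2 * (lam j + v))) *
              Real.exp (-(Z j y) ^ 2 / (2 * (lam j + v)))) := by ring
        _ = 1 := by rw [e1, e2, one_mul]
    simp [hinner]
  -- the integral of `h`
  have hZL2 : ∀ j, MemLp (Z j) 2 N := fun j => memLp_sum_mul_pi_gaussianReal v (O j)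
  have hZsq : ∀ j, ∫ z, Z j z ^ 2 ∂N = v := fun j => by
    have := integral_sum_mul_sq_pi_gaussianReal v (O j)
    have h1 := hK.1.sum_eigenvector_mul j j
    rw [if_pos rfl] at h1
    simp only [← sq] at h1
    rw [show ∑ m, O j m ^ 2 = 1 from h1, mul_one] at this
    exact this
  have hFsq : ∀ j, ∫ f, F j f ^ 2 ∂ν = lam j := fun j => by
    rw [← variance_of_integral_eq_zero (hFm j).aemeasurable (hFmean j), hFvar]
  have hcomp : ∀ z, h (T z) = ∑ j, ((F j z.1 + Z j z.2) ^ 2 / (2 * (lam j + v)) -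
      (Z j z.2) ^ 2 / (2 * v) + Real.log ((lam j + v) / v) / 2) := fun z => by
    simp only [hh]
    refine Finset.sum_congr rfl fun j _ => ?_
    have : Z j (T z).2 = F j z.1 + Z j z.2 := by
      simp only [hT, hZ, hF, ← Finset.sum_add_distrib, mul_add]
    rw [this]
    simp [hT]
  have hF2 : ∀ j, MemLp (fun z : (X → ℝ) × (Fin n → ℝ) => F j z.1) 2 (ν.prod N) := fun j =>
    (hFL2 j).comp_fst N
  have hZ2 : ∀ j, MemLp (fun z : (X → ℝ) × (Fin n → ℝ) => Z j z.2) 2 (ν.prod N) := fun j =>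
    (hZL2 j).comp_snd ν
  have hFZint : ∀ j, Integrable (fun z : (X → ℝ) × (Fin n → ℝ) => F j z.1 * Z j z.2)
      (ν.prod N) := fun j => (hF2 j).integrable_mul (hZ2 j)
  have hFZ0 : ∀ j, ∫ z : (X → ℝ) × (Fin n → ℝ), F j z.1 * Z j z.2 ∂(ν.prod N) = 0 := fun j => by
    rw [integral_prod_mul (F j) (Z j), hFmean, zero_mul]
  have hsum : ∀ j, ∫ z : (X → ℝ) × (Fin n → ℝ), (F j z.1 + Z j z.2) ^ 2 ∂(ν.prod N) =
      lam j + v := fun j => by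
    have e : ∀ z : (X → ℝ) × (Fin n → ℝ), (F j z.1 + Z j z.2) ^ 2 =
      (F j z.1 ^ 2 + Z j z.2 ^ 2) + 2 * (F j z.1 * Z j z.2) := fun z => by ring
    simp_rw [e]
    have i1 : Integrable (fun z : (X → ℝ) × (Fin n → ℝ) => F j z.1 ^ 2 + Z j z.2 ^ 2)
      (ν.prod N) := (hF2 j).integrable_sq.add (hZ2 j).integrable_sq
    rw [integral_add i1 ((hFZint j).const_mul 2),
      integral_add (hF2 j).integrable_sq (hZ2 j).integrable_sq, integral_const_mul, hFZ0,
      integral_fun_fst (fun f => F j f ^ 2), integral_fun_snd (fun z => Z j z ^ 2), hFsq, hZsq]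
    simp
  have hterm : ∀ j, Integrable (fun z : (X → ℝ) × (Fin n → ℝ) =>
      (F j z.1 + Z j z.2) ^ 2 / (2 * (lam j + v)) -
      (Z j z.2) ^ 2 / (2 * v) + Real.log ((lam j + v) / v) / 2) (ν.prod N) := fun j =>
    ((((hF2 j).add (hZ2 j)).integrable_sq.div_const _).sub
      ((hZ2 j).integrable_sq.div_const _)).add (integrable_const _)
  have hhint : Integrable h (obsLaw ν v x) := by
    rw [hρ, integrable_map_measure hhm.aestronglyMeasurable hTm.aemeasurable]
    simp only [Function.comp_def, hcomp]
    exact integrable_finsetSum _ fun j _ => hterm j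
  -- Both quadratic terms have mean `1/2` and cancel; only the logarithms survive.
  have hval : ∫ z, h z ∂(obsLaw ν v x) = ∑ j, Real.log ((lam j + v) / v) / 2 := by
    rw [hρ, integral_map hTm.aemeasurable hhm.aestronglyMeasurable]
    simp only [hcomp]
    rw [integral_finsetSum _ fun j _ => hterm j]
    refine Finset.sum_congr rfl fun j _ => ?_
    have hp : 0 < lam j + v := by have := hlam0 j; positivity
    have i1 : Integrable (fun z : (X → ℝ) × (Fin n → ℝ) =>
        (F j z.1 + Z j z.2) ^ 2 / (2 * (lam j + v))) (ν.prod N) :=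
      ((hF2 j).add (hZ2 j)).integrable_sq.div_const _
    have i2 : Integrable (fun z : (X → ℝ) × (Fin n → ℝ) => Z j z.2 ^ 2 / (2 * (v : ℝ)))
      (ν.prod N) := (hZ2 j).integrable_sq.div_const _
    rw [integral_add (i1.sub' i2) (integrable_const _), integral_sub i1 i2, integral_div,
      integral_div, hsum j, integral_fun_snd (fun z => Z j z ^ 2), hZsq]
    simp only [probReal_univ, smul_eq_mul, one_mul, integral_const]
    field_simp
    ring
  have hdet : Real.log ((regGram k v x).det / (v : ℝ) ^ n) / 2 =
      ∑ j, Real.log ((lam j + v) / v) / 2 := by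
    rw [← Finset.sum_div, ← Real.log_prod fun j _ => by have := hlam0 j; positivity,
      Finset.prod_div_distrib, regGram, hK.1.det_add_smul_one]
    simp [hlam]
  rw [hdet, ← hval]
  exact ofReal_integral_le_klDiv hhm hhint hexp

end SafeOptMC

/-! ### Information gain, growth counting and reachable sets -/

namespace SafeOptMC

lemma sum_log_le_infoGain {α : Type*} [Fintype α] {q : ℕ} (ν : Measure (α × Fin (q + 1) → ℝ))
    [IsGaussian ν] {k : α × Fin (q + 1) → α × Fin (q + 1) → ℝ} (hk : (Matrix.of k).PosSemidef)
    (hmean : ∀ z, ∫ f, f z ∂ν = 0) (hcov : ∀ z z', cov[fun f => f z, fun f => f z'; ν] = k z z')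
    {v : ℝ≥0} (hv : 0 < v) (a : ℕ → α) (i : ℕ → Fin (q + 1)) (n : ℕ) :
    ENNReal.ofReal ((∑ t ∈ Finset.range n, Real.log (1 + postVar k v
        (fun j : Fin t × Fin (q + 1) => (a j.1, j.2)) (a t, i t) / v)) / 2) ≤
      infoGain ν v ((q + 1) * n) := by
  set f : Fin ((q + 1) * n) ≃ Fin n × Fin (q + 1) :=
    finProdFinEquiv.symm.trans (Equiv.prodComm _ _)
  refine le_trans ?_ (le_iSup _ ((fun j : Fin n × Fin (q + 1) => (a j.1, j.2)) ∘ f))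
  refine le_trans ?_ (log_det_le_mutualInfo ν hk hmean hcov hv _)
  rw [det_regGram_comp_equiv]
  have h := sum_log_le_log_det hk (by exact_mod_cast hv : (0 : ℝ) < v) a i n
  have hc : Fintype.card (Fin n × Fin (q + 1)) = (q + 1) * n := by simp [mul_comm]
  rw [hc] at h
  gcongr

/-- Bernoulli's inequality for exponents in `[0, 1]`. It converts posterior variances into
information and is the source of the logarithm in `C_1`. -/
lemma mul_log_one_add_le {s c : ℝ} (hs₀ : 0 ≤ s) (hs₁ : s ≤ 1) (hc : 0 ≤ c) :
    s * Real.log (1 + c) ≤ Real.log (1 + s * c) := by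
  rw [← Real.log_rpow (by positivity)]
  exact Real.log_le_log (by positivity)
    (rpow_one_add_le_one_add_mul_self (by linarith) hs₀ hs₁)

lemma card_ne_succ_add_ncard_le {α : Type*} [Finite α] (T : ℕ → Set α)
    (hT : ∀ n, T n ⊆ T (n + 1)) (m : ℕ) [DecidablePred fun n => T n ≠ T (n + 1)] :
    ((Finset.range m).filter fun n => T n ≠ T (n + 1)).card + (T 0).ncard ≤ (T m).ncard := by
  induction m with
  | zero => simp
  | succ m ih =>
    rw [Finset.range_add_one, Finset.filter_insert]
    split_ifs with h
    · rw [Finset.card_insert_of_notMem (by simp)]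
      have := Set.ncard_lt_ncard ((hT m).ssubset_of_ne h)
      omega
    · rw [← not_ne_iff.1 h]
      exact ih

section Reachable

variable {E : Type*} [NormedAddCommGroup E] {A : Finset E} {q : ℕ} {L : ℝ≥0}
  {p : A × Fin (q + 1) → ℝ} {ε : ℝ}

lemma reach_mono {S T : Set A} (h : S ⊆ T) : reach L p ε S ⊆ reach L p ε T :=
  Set.union_subset_union h fun _ ha i hi =>
    let ⟨c, hc, h'⟩ := ha i hi
    ⟨c, h hc, h'⟩

lemma subset_reachLim (S : Set A) : S ⊆ reachLim L p ε S :=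
  Set.subset_iUnion_of_subset 0 subset_rfl

lemma reachLim_subset {S T : Set A} (hST : S ⊆ T) (hT : reach L p ε T ⊆ T) :
    reachLim L p ε S ⊆ T := by
  refine Set.iUnion_subset fun n => ?_
  induction n with
  | zero => exact hST
  | succ n ih =>
    rw [Function.iterate_succ_apply']
    exact (reach_mono ih).trans hT

lemma exists_eq_fStar {S : Set A} (hS : S.Nonempty) :
    ∃ b ∈ reachLim L p ε S, p (b, 0) = fStar L p ε S :=
  ((hS.mono (subset_reachLim S)).image _).csSup_mem (Set.toFinite _)

end Reachable

/-! ### Deterministic analysis on the calibrated event -/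

namespace Input

variable {E : Type*} [NormedAddCommGroup E] {A : Finset E} {q : ℕ} {I : Input A q}
  {a : ℕ → A} {y : ℕ → Fin (q + 1) → ℝ} {p : A × Fin (q + 1) → ℝ}

/-- The event that the surrogate function respects all confidence bounds and the prior knowledge
about the initial safe set. -/
structure WellCalibrated (I : Input A q) (a : ℕ → A) (y : ℕ → Fin (q + 1) → ℝ)
    (p : A × Fin (q + 1) → ℝ) : Prop where
  conf : ∀ n z, |p z - I.μ a y n z| ≤ √(I.β (n + 1)) * I.σ a n z
  init : ∀ i ∈ I.J, ∀ b ∈ I.S₀, 0 ≤ p (b, i)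
  mem_J : ∀ i : Fin (q + 1), i ≠ 0 → i ∈ I.J

lemma C_succ_subset (n : ℕ) (z : A × Fin (q + 1)) : I.C a y (n + 1) z ⊆ I.C a y n z :=
  Set.inter_subset_left

lemma C_antitone (z : A × Fin (q + 1)) : Antitone fun n => I.C a y n z :=
  antitone_nat_of_succ_le fun n => C_succ_subset n z

lemma bddBelow_C {n : ℕ} (hn : 1 ≤ n) (z : A × Fin (q + 1)) : BddBelow (I.C a y n z) :=
  (bddBelow_Icc.mono Set.inter_subset_right : BddBelow (I.C a y (0 + 1) z)).mono
    (C_antitone z hn)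

lemma bddAbove_C {n : ℕ} (hn : 1 ≤ n) (z : A × Fin (q + 1)) : BddAbove (I.C a y n z) :=
  (bddAbove_Icc.mono Set.inter_subset_right : BddAbove (I.C a y (0 + 1) z)).mono
    (C_antitone z hn)

namespace WellCalibrated

variable (h : I.WellCalibrated a y p)
include h

lemma mem_C (n : ℕ) (z : A × Fin (q + 1)) : p z ∈ I.C a y n z := by
  induction n with
  | zero =>
    rw [C]
    split_ifs with hz
    · exact h.init z.2 hz.2 z.1 hz.1
    · trivial
  | succ n ih =>
    have := abs_le.1 (h.conf n z)
    exact ⟨ih, by linarith, by linarith⟩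

lemma l_le {n : ℕ} (hn : 1 ≤ n) (z : A × Fin (q + 1)) : I.l a y n z ≤ p z :=
  csInf_le (bddBelow_C hn z) (h.mem_C n z)

lemma le_u {n : ℕ} (hn : 1 ≤ n) (z : A × Fin (q + 1)) : p z ≤ I.u a y n z :=
  le_csSup (bddAbove_C hn z) (h.mem_C n z)

lemma l_mono {m n : ℕ} (hm : 1 ≤ m) (hmn : m ≤ n) (z : A × Fin (q + 1)) :
    I.l a y m z ≤ I.l a y n z :=
  csInf_le_csInf (bddBelow_C hm z) ⟨_, h.mem_C n z⟩ (C_antitone z hmn)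

/-- The initial set `C 0` records the prior knowledge, and later confidence sets can only shrink;
this is what keeps `S₀` inside the next safe set. -/
lemma l_nonneg {b : A} (hb : b ∈ I.S₀) {i : Fin (q + 1)} (hi : i ∈ I.J) (n : ℕ) :
    0 ≤ I.l a y n (b, i) := by
  refine le_csInf ⟨_, h.mem_C n _⟩ fun x hx => ?_
  have := C_antitone (b, i) (Nat.zero_le n) hx
  simpa [C, hb, hi] using this

lemma w_nonneg {n : ℕ} (hn : 1 ≤ n) (z : A × Fin (q + 1)) : 0 ≤ I.w a y n z :=
  sub_nonneg.2 ((h.l_le hn z).trans (h.le_u hn z))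

lemma w_succ_le (n : ℕ) (z : A × Fin (q + 1)) :
    I.w a y (n + 1) z ≤ 2 * (√(I.β (n + 1)) * I.σ a n z) := by
  have h1 : I.u a y (n + 1) z ≤ I.μ a y n z + √(I.β (n + 1)) * I.σ a n z :=
    csSup_le ⟨_, h.mem_C _ z⟩ fun x hx => hx.2.2
  have h2 : I.μ a y n z - √(I.β (n + 1)) * I.σ a n z ≤ I.l a y (n + 1) z :=
    le_csInf ⟨_, h.mem_C _ z⟩ fun x hx => hx.2.1
  rw [w]
  linarith

lemma S_subset_succ (n : ℕ) : I.S a y n ⊆ I.S a y (n + 1) := by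
  induction n with
  | zero => exact fun b hb i hi => ⟨b, hb, by simpa using h.l_nonneg hb (h.mem_J i hi) 1⟩
  | succ n ih =>
    intro b hb i hi
    obtain ⟨c, hc, hl⟩ := hb i hi
    exact ⟨c, ih hc, hl.trans (sub_le_sub_right (h.l_mono (by omega) (by omega) _) _)⟩

lemma S_mono : Monotone (I.S a y) := monotone_nat_of_le_succ h.S_subset_succ

lemma S_subset_reach (n : ℕ) : I.S a y n ⊆ (reach I.L p 0)^[n] I.S₀ := by
  induction n with
  | zero => exact subset_rfl
  | succ n ih =>
    rw [Function.iterate_succ_apply']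
    intro b hb
    refine Or.inr fun i hi => ?_
    obtain ⟨c, hc, hl⟩ := hb i hi
    have := h.l_le (n := n + 1) (by omega) (c, i)
    rw [norm_sub_rev] at hl
    exact ⟨c, ih hc, by linarith⟩

lemma S_subset_reachLim (n : ℕ) : I.S a y n ⊆ reachLim I.L p 0 I.S₀ :=
  (h.S_subset_reach n).trans (Set.subset_iUnion (fun n => (reach I.L p 0)^[n] I.S₀) n)

lemma S_nonempty (hS₀ : I.S₀.Nonempty) (n : ℕ) : (I.S a y n).Nonempty :=
  hS₀.mono (h.S_mono (Nat.zero_le n))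

lemma M_nonempty (hS₀ : I.S₀.Nonempty) {n : ℕ} (hn : 1 ≤ n) : (I.M a y n).Nonempty := by
  obtain ⟨b, hb, hmax⟩ := Set.exists_max_image (I.S a y n) (fun c => I.l a y n (c, 0))
    (Set.toFinite _) (h.S_nonempty hS₀ n)
  exact ⟨b, hb, fun c hc => (hmax c hc).trans ((h.l_le hn _).trans (h.le_u hn _))⟩

lemma nonneg_of_mem_S (hlip : ∀ i, ∀ b c : A, |p (b, i) - p (c, i)| ≤ I.L * ‖(b : E) - (c : E)‖)
    {n : ℕ} {b : A} (hb : b ∈ I.S a y n) {i : Fin (q + 1)} (hi : i ≠ 0) : 0 ≤ p (b, i) := by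
  cases n with
  | zero => exact h.init i (h.mem_J i hi) b hb
  | succ n =>
    obtain ⟨c, -, hl⟩ := hb i hi
    have h1 := h.l_le (n := n + 1) (by omega) (c, i)
    have h2 := (abs_le.1 (hlip i c b)).2
    linarith

/-- If the safe set does not grow although all remaining uncertainty about the expanders is at most
`ε`, then it is closed under `R_ε`. -/
lemma reach_subset_S (hθ : I.θ ≤ 1) {ε : ℝ} (hε : 0 ≤ ε) {n : ℕ} (hn : 1 ≤ n)
    (hstall : I.S a y n = I.S a y (n + 1))
    (hw : ∀ c ∈ I.G a y n, ∀ j, I.w a y n (c, j) ≤ ε) :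
    reach I.L p ε (I.S a y n) ⊆ I.S a y n := by
  refine Set.union_subset subset_rfl fun b hb => ?_
  by_contra hbS
  refine hbS ?_
  rw [hstall]
  intro i hi
  obtain ⟨c, hc, hpc⟩ := hb i hi
  refine ⟨c, hc, ?_⟩
  have hu := h.le_u hn (c, i)
  -- The true value already certifies `b` from `c`, so the optimistic bound does too: `c` could add
  -- a point outside the safe set, which is enough for either value of `θ`.
  have hG : c ∈ I.G a y n := by
    refine ⟨hc, hθ.trans ?_⟩
    rw [norm_sub_rev] at hpc
    exact (Set.ncard_pos).2 ⟨b, hbS, i, hi, by linarith⟩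
  have h1 := hw c hG i
  rw [w] at h1
  have h2 := h.l_mono hn (Nat.le_succ n) (c, i)
  rw [norm_sub_rev] at hpc
  simp only [Nat.succ_eq_add_one] at h2
  linarith

lemma fStar_sub_le (hS₀ : I.S₀.Nonempty) (hθ : I.θ ≤ 1) {ε : ℝ} (hε : 0 ≤ ε) {n : ℕ}
    (hn : 1 ≤ n) (hstall : I.S a y n = I.S a y (n + 1))
    (hw : ∀ c ∈ I.G a y n ∪ I.M a y n, ∀ j, I.w a y n (c, j) ≤ ε) {m : ℕ} (hm : n ≤ m) {b : A}
    (hb : b ∈ I.bestEstimates a y m) :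
    fStar I.L p ε I.S₀ - ε ≤ p (b, 0) := by
  obtain ⟨c, hc, hcf⟩ := exists_eq_fStar (L := I.L) (p := p) (ε := ε) hS₀
  have hcS : c ∈ I.S a y n := reachLim_subset (h.S_mono (Nat.zero_le n))
    (h.reach_subset_S hθ hε hn hstall fun c hc => hw c (Or.inl hc)) hc
  rw [← hcf]
  have h1 := h.l_le (hn.trans hm) (b, 0)
  -- Safe sets and lower bounds only increase, so the pessimistic choice at the later time `m` beats
  -- every lower bound available at time `n`.
  have key : ∀ d ∈ I.S a y n, I.l a y n (d, 0) ≤ p (b, 0) := fun d hd =>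
    (h.l_mono hn hm _).trans ((hb.2 d (h.S_mono hm hd)).trans h1)
  have hu := h.le_u hn (c, 0)
  by_cases hM : c ∈ I.M a y n
  · have h2 := hw c (Or.inr hM) 0
    rw [w] at h2
    have := key c hcS
    linarith
  -- A point is excluded from the maximizers only because another lower bound exceeds its upper
  -- bound, and that is even better.
  · have : ∃ d ∈ I.S a y n, I.u a y n (c, 0) < I.l a y n (d, 0) := by
      by_contra! hcon
      exact hM ⟨hcS, hcon⟩
    obtain ⟨d, hd, hlt⟩ := this
    have := key d hd
    linarith

/-- A small cumulative width forces an iteration in which the safe set does not grow and all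
relevant widths are at most `ε`. -/
lemma exists_stall (hS₀ : I.S₀.Nonempty) {ε : ℝ} (hε : 0 ≤ ε) {N D : ℕ}
    (hD : (reachLim I.L p 0 I.S₀).ncard = D) (hN : D + 1 ≤ N) (W : ℕ → ℝ)
    (hW : (∑ n ∈ Finset.range N, W n ^ 2) * (D + 1) ≤ N * ε ^ 2) :
    ∃ n < N, I.S a y (n + 1) = I.S a y (n + 2) ∧ n + 1 < N ∧ W n ≤ ε := by
  classical
  by_contra! hcon
  set T : ℕ → Set A := fun n => I.S a y (n + 1) with hT
  -- Only `N - 1` steps are inspected, and the first safe set is already nonempty, so at most `D -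
  -- 1` of them are growth steps and at least `N - D` are not.
  set bad := (Finset.range (N - 1)).filter fun n => T n ≠ T (n + 1) with hbad
  have h1 : bad.card + (T 0).ncard ≤ (T (N - 1)).ncard :=
    card_ne_succ_add_ncard_le T (fun n => h.S_subset_succ (n + 1)) (N - 1)
  have h2 : (T (N - 1)).ncard ≤ D := hD ▸ Set.ncard_le_ncard (h.S_subset_reachLim _)
  have h3 : 0 < (T 0).ncard := (Set.ncard_pos).2 (h.S_nonempty hS₀ _)
  set good := (Finset.range (N - 1)) \ bad with hgood
  have h4 : good.card = N - 1 - bad.card := by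
    rw [hgood, Finset.card_sdiff_of_subset (Finset.filter_subset _ _), Finset.card_range]
  have h5 : N - D ≤ good.card := by omega
  have hgt : ∀ n ∈ good, ε ^ 2 < W n ^ 2 := fun n hn => by
    simp only [hgood, hbad, Finset.mem_sdiff, Finset.mem_filter, Finset.mem_range, not_and,
      not_not] at hn
    have := hcon n (by omega) (hn.2 hn.1) (by omega)
    gcongr
  have hne : good.Nonempty := Finset.card_pos.1 (by omega)
  have h6 : good.card * ε ^ 2 < ∑ n ∈ good, W n ^ 2 := by
    rw [← nsmul_eq_mul, ← Finset.sum_const]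
    exact Finset.sum_lt_sum_of_nonempty hne hgt
  have h7 : ∑ n ∈ good, W n ^ 2 ≤ ∑ n ∈ Finset.range N, W n ^ 2 :=
    Finset.sum_le_sum_of_subset_of_nonneg
      (Finset.sdiff_subset.trans (Finset.range_subset_range.2 (by omega))) fun _ _ _ => sq_nonneg _
  -- `(N - D)(D + 1) - N = D (N - D - 1)`, which is nonnegative because `N ≥ D + 1`.
  have h8 : (N : ℝ) ≤ good.card * (D + 1) := by
    have h9 : (D : ℝ) + 1 ≤ N := by exact_mod_cast hN
    have h10 : (N : ℝ) - D ≤ good.card := by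
      rw [← Nat.cast_sub (by omega)]
      exact_mod_cast h5
    have hD0 : (0 : ℝ) ≤ D := Nat.cast_nonneg D
    nlinarith
  have h11 : 0 ≤ ε ^ 2 := sq_nonneg ε
  have hD0 : (0 : ℝ) < (D : ℝ) + 1 := by positivity
  nlinarith

end WellCalibrated

end Input

end SafeOptMC

/-! ### From the threshold on the budget to near-optimality -/

namespace SafeOptMC

/-- Removes the extended quotients. For `s ≤ 0` the claim is a sign statement; otherwise the
right-hand quotient is finite, which excludes `e = 0`. -/
lemma mul_le_of_div_le_div {c e b s : ℝ} {Γ : ℝ≥0∞} {N : ℕ} (hc : 0 < c) (he : 0 ≤ e) (hb : 0 < b)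
    (hs : ENNReal.ofReal s ≤ Γ)
    (h : ENNReal.ofReal c / ENNReal.ofReal e ≤ (N : ℝ≥0∞) / (ENNReal.ofReal b * Γ)) :
    c * b * s ≤ N * e := by
  rcases le_or_gt s 0 with hs0 | hs0
  · exact (mul_nonpos_of_nonneg_of_nonpos (by positivity) hs0).trans (by positivity)
  have h1 : ENNReal.ofReal c / ENNReal.ofReal e ≤ ENNReal.ofReal (N / (b * s)) := by
    rw [ENNReal.ofReal_div_of_pos (by positivity), ENNReal.ofReal_natCast,
      ENNReal.ofReal_mul hb.le]
    exact h.trans (by gcongr)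
  rcases he.eq_or_lt with rfl | he0
  · simp [ENNReal.div_zero, hc] at h1
  rw [← ENNReal.ofReal_div_of_pos he0, ENNReal.ofReal_le_ofReal_iff (by positivity),
    div_le_div_iff₀ he0 (by positivity)] at h1
  linarith

namespace Input.WellCalibrated

variable {E : Type*} [NormedAddCommGroup E] {A : Finset E} {q : ℕ} {I : Input A q}
  {a : ℕ → A} {y : ℕ → Fin (q + 1) → ℝ} {p : A × Fin (q + 1) → ℝ}

lemma sq_w_succ_le (h : I.WellCalibrated a y p) (hk : (Matrix.of I.k).PosSemidef) (hv : 0 < I.v)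
    {n : ℕ} (hβ : 0 ≤ I.β (n + 1)) (z : A × Fin (q + 1)) :
    I.w a y (n + 1) z ^ 2 ≤ 4 * I.β (n + 1) * postVar I.k I.v (design a n) z := by
  have h1 := h.w_succ_le n z
  have h2 := h.w_nonneg (n := n + 1) (by omega) z
  have h3 := postVar_nonneg hk (by exact_mod_cast hv : (0 : ℝ) < I.v) (design a n) z
  calc I.w a y (n + 1) z ^ 2 ≤ (2 * (√(I.β (n + 1)) * I.σ a n z)) ^ 2 := by gcongr
    _ = 4 * (√(I.β (n + 1)) ^ 2 * I.σ a n z ^ 2) := by ring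
    _ = _ := by rw [Real.sq_sqrt hβ, σ, Real.sq_sqrt h3]; ring

/-- The confidence bound before any measurement: posterior mean zero and posterior variance equal to
the prior one. -/
lemma sq_le (h : I.WellCalibrated a y p) (hk : (Matrix.of I.k).PosSemidef)
    (hβ : 0 ≤ I.β 1) (z : A × Fin (q + 1)) : p z ^ 2 ≤ I.β 1 * I.k z z := by
  have h1 := h.conf 0 z
  have hkz : 0 ≤ I.k z z := hk.diag_nonneg (i := z)
  have hμ : I.μ a y 0 z = 0 := by simp [μ, postMean]
  rw [hμ, sub_zero, σ, postVar_of_isEmpty, zero_add, ← Real.sqrt_mul hβ] at h1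
  rw [← sq_abs, ← Real.sq_sqrt (mul_nonneg hβ hkz)]
  gcongr

/-- Once the sampling budget exceeds the threshold, the pessimistic estimate is `ε`-optimal. -/
lemma fStar_sub_le_of_threshold (h : I.WellCalibrated a y p) (hk : (Matrix.of I.k).PosSemidef)
    (hv : 0 < I.v) (hS₀ : I.S₀.Nonempty) (hθ : I.θ ≤ 1) {ε : ℝ} (hε : 0 ≤ ε)
    (hk1 : ∀ z, I.k z z ≤ 1) (hβpos : ∀ n, 1 ≤ n → 0 < I.β n)
    (hβmono : ∀ m n, 1 ≤ m → m ≤ n → I.β m ≤ I.β n)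
    (hacq : ∀ n, a n ∈ I.acquisition a y (n + 1)) {N : ℕ} (hN : 0 < N) {Γ : ℝ≥0∞}
    (hΓ : ∀ (b : ℕ → A) (i : ℕ → Fin (q + 1)), ENNReal.ofReal ((∑ t ∈ Finset.range N,
      Real.log (1 + postVar I.k I.v (design b t) (b t, i t) / I.v)) / 2) ≤ Γ)
    (hle : ENNReal.ofReal (8 / Real.log (1 + (I.v : ℝ)⁻¹) *
        (((reachLim I.L p 0 I.S₀).ncard : ℝ) + 1)) / ENNReal.ofReal (ε ^ 2) ≤
      (N : ℝ≥0∞) / (ENNReal.ofReal (I.β N) * Γ)) {m : ℕ} (hm : N ≤ m) {b : A}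
    (hb : b ∈ I.bestEstimates a y m) :
    fStar I.L p ε I.S₀ - ε ≤ p (b, 0) := by
  have hv0 : (0 : ℝ) < I.v := by exact_mod_cast hv
  set D := (reachLim I.L p 0 I.S₀).ncard with hD
  set ell := Real.log (1 + (I.v : ℝ)⁻¹) with hell
  have hell0 : 0 < ell := Real.log_pos (by simpa using hv0)
  have hβN := hβpos N hN
  -- Stated for arbitrary input sequences: it is applied both to the actual run and to constant
  -- sequences.
  have key : ∀ (b : ℕ → A) (i : ℕ → Fin (q + 1)),
      8 / ell * ((D : ℝ) + 1) * I.β N * ((∑ t ∈ Finset.range N,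
        Real.log (1 + postVar I.k I.v (design b t) (b t, i t) / I.v)) / 2) ≤ N * ε ^ 2 :=
    fun b i => mul_le_of_div_le_div (by positivity) (sq_nonneg ε) hβN (hΓ b i) hle
  have hpv0 : ∀ (b : ℕ → A) t z, 0 ≤ postVar I.k I.v (design b t) z := fun b t z =>
    postVar_nonneg hk hv0 _ _
  have hlog : ∀ (b : ℕ → A) t z, postVar I.k I.v (design b t) z * ell ≤
      Real.log (1 + postVar I.k I.v (design b t) z / I.v) := fun b t z => by
    rw [div_eq_mul_inv]
    exact mul_log_one_add_le (hpv0 b t z) ((postVar_le hk hv0 _ _).trans (hk1 z))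
      (inv_nonneg.2 hv0.le)
  have key' : ∀ (b : ℕ → A) (i : ℕ → Fin (q + 1)), 4 * I.β N * (∑ t ∈ Finset.range N,
      postVar I.k I.v (design b t) (b t, i t)) * ((D : ℝ) + 1) ≤ N * ε ^ 2 := fun b i => by
    refine le_trans ?_ (key b i)
    have : (∑ t ∈ Finset.range N, postVar I.k I.v (design b t) (b t, i t)) * ell ≤
        ∑ t ∈ Finset.range N,
          Real.log (1 + postVar I.k I.v (design b t) (b t, i t) / I.v) := by
      rw [Finset.sum_mul]
      exact Finset.sum_le_sum fun t _ => hlog b t _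
    rw [← le_div_iff₀ hell0] at this
    calc _ ≤ 4 * I.β N * ((∑ t ∈ Finset.range N,
          Real.log (1 + postVar I.k I.v (design b t) (b t, i t) / I.v)) / ell) *
            ((D : ℝ) + 1) := by gcongr
      _ = _ := by ring
  rcases Nat.lt_or_ge D N with hDN | hDN
  · have hex : ∀ n, ∃ i, ∀ c ∈ I.G a y (n + 1) ∪ I.M a y (n + 1), ∀ j,
        I.w a y (n + 1) (c, j) ≤ I.w a y (n + 1) (a n, i) := fun n => (hacq n).2
    choose i hi using hex
    obtain ⟨n, hnN, hstall, hnN', hwn⟩ := h.exists_stall hS₀ hε hD.symm hDN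
      (fun n => I.w a y (n + 1) (a n, i n)) (by
        refine le_trans ?_ (key' a i)
        gcongr
        rw [Finset.mul_sum]
        refine Finset.sum_le_sum fun t ht => ?_
        have ht' := Finset.mem_range.1 ht
        refine (h.sq_w_succ_le hk hv (hβpos (t + 1) (by omega)).le _).trans ?_
        have := hβmono (t + 1) N (by omega) (by omega)
        have := hpv0 a t (a t, i t)
        gcongr)
    exact h.fStar_sub_le hS₀ hθ hε (n := n + 1) (by omega) hstall
      (fun c hc j => (hi n c hc j).trans hwn) (by omega) hb
  -- The budget is at most `D`. Sampling `z` forever yields at least its prior variance in the first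
  -- term, so the threshold gives `4 β_N k(z, z) ≤ ε²`; with `sq_le` every value is small and any
  -- point is `ε`-optimal.
  · have hsmall : ∀ z, |p z| ≤ ε / 2 := fun z => by
      have h1 := key' (fun _ => z.1) (fun _ => z.2)
      have h2 : I.k z z ≤ ∑ t ∈ Finset.range N,
          postVar I.k I.v (design (fun _ => z.1) t) (z.1, z.2) := by
        refine le_trans ?_ (Finset.single_le_sum (fun t _ => hpv0 _ t _) (Finset.mem_range.2 hN))
        rw [postVar_of_isEmpty]
      have h3 := h.sq_le hk (hβpos 1 le_rfl).le z
      have h4 := hβmono 1 N le_rfl hN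
      have hkz : 0 ≤ I.k z z := hk.diag_nonneg (i := z)
      have h5 : (N : ℝ) ≤ D + 1 := by exact_mod_cast hDN.trans (Nat.le_succ D)
      have h6 : 4 * p z ^ 2 * ((D : ℝ) + 1) ≤ ε ^ 2 * ((D : ℝ) + 1) :=
        calc 4 * p z ^ 2 * ((D : ℝ) + 1) ≤ 4 * (I.β N * I.k z z) * ((D : ℝ) + 1) := by
              gcongr
              exact h3.trans (by gcongr)
          _ = 4 * I.β N * I.k z z * ((D : ℝ) + 1) := by ring
          _ ≤ 4 * I.β N * (∑ t ∈ Finset.range N,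
                postVar I.k I.v (design (fun _ => z.1) t) (z.1, z.2)) * ((D : ℝ) + 1) := by
              gcongr
          _ ≤ N * ε ^ 2 := h1
          _ ≤ (D + 1) * ε ^ 2 := by gcongr
          _ = _ := by ring
      have h7 := le_of_mul_le_mul_right h6 (by positivity)
      exact abs_le_of_sq_le_sq (by linarith) (by linarith)
    obtain ⟨c, -, hc⟩ := exists_eq_fStar (L := I.L) (p := p) (ε := ε) hS₀
    have h1 := (abs_le.1 (hsmall (c, 0))).2
    have h2 := (abs_le.1 (hsmall (b, 0))).1
    linarith

end Input.WellCalibrated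

end SafeOptMC

/-! ### Gaussian tails and independence -/

namespace SafeOptMC

/-- Shift by `r` and drop the nonnegative cross term in the exponent. Keeping the mass of the
half-line on the right lets two tails add up without a factor 2. -/
lemma gaussianReal_Ioi_le {s : ℝ≥0} (hs : s ≠ 0) {r : ℝ} (hr : 0 ≤ r) :
    gaussianReal 0 s (Set.Ioi r) ≤
      ENNReal.ofReal (Real.exp (-r ^ 2 / (2 * s))) * gaussianReal 0 s (Set.Ioi 0) := by
  have hs0 : 0 < (s : ℝ) := by positivity
  rw [gaussianReal_apply _ hs, gaussianReal_apply _ hs, ← lintegral_indicator measurableSet_Ioi,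
    ← lintegral_indicator measurableSet_Ioi,
    ← lintegral_add_right_eq_self (fun x => (Set.Ioi r).indicator (gaussianPDF 0 s) x) r,
    ← lintegral_const_mul _ ((measurable_gaussianPDF 0 s).indicator measurableSet_Ioi)]
  refine lintegral_mono fun x => ?_
  by_cases hx : 0 < x
  · have hx' : x + r ∈ Set.Ioi r := by simpa using hx
    simp only [Set.indicator_of_mem hx', Set.indicator_of_mem (Set.mem_Ioi.2 hx), gaussianPDF]
    rw [← ENNReal.ofReal_mul (Real.exp_pos _).le]
    apply ENNReal.ofReal_le_ofReal
    simp only [gaussianPDFReal, sub_zero]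
    rw [mul_left_comm, ← Real.exp_add]
    gcongr
    rw [← add_div, div_le_div_iff_of_pos_right (by positivity)]
    nlinarith [mul_nonneg hr hx.le]
  · have hx' : x + r ∉ Set.Ioi r := by simpa using hx
    simp [Set.indicator_of_notMem hx']

/-- The two-sided Gaussian tail bound. -/
lemma gaussianReal_abs_gt_le (s : ℝ≥0) {c : ℝ} (hc : 0 ≤ c) :
    gaussianReal 0 s {x | c * √s < |x|} ≤ ENNReal.ofReal (Real.exp (-c ^ 2 / 2)) := by
  rcases eq_or_ne s 0 with rfl | hs
  · rw [gaussianReal_zero_var, Measure.dirac_apply' _ (measurableSet_lt (by fun_prop) (by fun_prop))]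
    simp
  have hs0 : 0 < (s : ℝ) := by positivity
  set r := c * √(s : ℝ) with hr
  have hr0 : 0 ≤ r := by positivity
  have hneg : ∀ t : ℝ, gaussianReal 0 s (Set.Iio (-t)) = gaussianReal 0 s (Set.Ioi t) := fun t => by
    have h := gaussianReal_map_neg (μ := 0) (v := s)
    rw [neg_zero] at h
    conv_lhs => rw [← h]
    rw [Measure.map_apply measurable_neg measurableSet_Iio]
    congr 1
    ext x
    simp
  have hsub : {x | r < |x|} ⊆ Set.Ioi r ∪ Set.Iio (-r) := fun x hx => by
    rcases lt_abs.1 (show r < |x| from hx) with h | h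
    · exact Or.inl h
    · exact Or.inr (by simpa using lt_neg_of_lt_neg h)
  have hhalf : gaussianReal 0 s (Set.Ioi 0) + gaussianReal 0 s (Set.Ioi 0) ≤ 1 := by
    conv_lhs => enter [2]; rw [← hneg 0]
    rw [← measure_union _ measurableSet_Iio]
    · exact prob_le_one
    · rw [neg_zero]
      exact Set.disjoint_left.2 fun x h1 h2 =>
        lt_asymm (Set.mem_Ioi.1 h1) (Set.mem_Iio.1 h2)
  have hexp : Real.exp (-r ^ 2 / (2 * s)) = Real.exp (-c ^ 2 / 2) := by
    congr 1
    rw [hr, mul_pow, Real.sq_sqrt hs0.le]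
    field_simp
  calc _ ≤ gaussianReal 0 s (Set.Ioi r) + gaussianReal 0 s (Set.Iio (-r)) :=
        (measure_mono hsub).trans (measure_union_le _ _)
    _ ≤ ENNReal.ofReal (Real.exp (-c ^ 2 / 2)) *
        (gaussianReal 0 s (Set.Ioi 0) + gaussianReal 0 s (Set.Ioi 0)) := by
        rw [hneg, mul_add, ← hexp]
        exact add_le_add (gaussianReal_Ioi_le hs hr0) (gaussianReal_Ioi_le hs hr0)
    _ ≤ _ := by
        conv_rhs => rw [← mul_one (ENNReal.ofReal _)]
        gcongr

/-- Factor the probability over the π-system of intersections. In the application the three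
σ-algebras come from the external randomness, the measurements and the regression error. -/
lemma indep_sup_of_indep {Ω : Type*} {m₁ m₂ m₃ mΩ : MeasurableSpace Ω} {P : Measure Ω}
    [IsProbabilityMeasure P] (h₁ : m₁ ≤ mΩ) (h₂ : m₂ ≤ mΩ) (h₃ : m₃ ≤ mΩ)
    (h : Indep m₁ (m₂ ⊔ m₃) P) (h' : Indep m₂ m₃ P) : Indep (m₁ ⊔ m₂) m₃ P := by
  set p : Set (Set Ω) := {s | ∃ u t, MeasurableSet[m₁] u ∧ MeasurableSet[m₂] t ∧ u ∩ t = s}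
  have hp : m₁ ⊔ m₂ = MeasurableSpace.generateFrom p := by
    apply le_antisymm
    · refine sup_le (fun u hu => ?_) fun t ht => ?_
      · exact MeasurableSpace.measurableSet_generateFrom
          ⟨u, Set.univ, hu, MeasurableSet.univ, Set.inter_univ u⟩
      · exact MeasurableSpace.measurableSet_generateFrom
          ⟨Set.univ, t, MeasurableSet.univ, ht, Set.univ_inter t⟩
    · refine MeasurableSpace.generateFrom_le ?_
      rintro _ ⟨u, t, hu, ht, rfl⟩
      exact MeasurableSet.inter ((le_sup_left : m₁ ≤ m₁ ⊔ m₂) u hu)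
        ((le_sup_right : m₂ ≤ m₁ ⊔ m₂) t ht)
  refine IndepSets.indep (sup_le h₁ h₂) h₃ (p1 := p) (p2 := {s | MeasurableSet[m₃] s}) ?_
    (@MeasurableSpace.isPiSystem_measurableSet _ m₃) hp
    (@MeasurableSpace.generateFrom_measurableSet _ m₃).symm ?_
  · rintro _ ⟨u, t, hu, ht, rfl⟩ _ ⟨u', t', hu', ht', rfl⟩ -
    exact ⟨u ∩ u', t ∩ t', hu.inter hu', ht.inter ht', Set.inter_inter_inter_comm _ _ _ _⟩
  · rw [IndepSets_iff]
    rintro _ s ⟨u, t, hu, ht, rfl⟩ hs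
    rw [Set.inter_assoc, (Indep_iff _ _ _).1 h u (t ∩ s) hu
      (MeasurableSet.inter ((le_sup_left : m₂ ≤ m₂ ⊔ m₃) t ht)
        ((le_sup_right : m₃ ≤ m₂ ⊔ m₃) s hs)),
      (Indep_iff _ _ _).1 h' t s ht hs, (Indep_iff _ _ _).1 h u t hu
      ((le_sup_left : m₂ ≤ m₂ ⊔ m₃) t ht), mul_assoc]

/-! ### The regression error for a fixed design -/

section Regression

variable {Ω : Type*} [MeasurableSpace Ω] {P : Measure Ω} [IsProbabilityMeasure P]
  {X ι : Type*} [Fintype X] [Fintype ι] [DecidableEq ι] {k : X → X → ℝ} {v : ℝ≥0}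
  {p : X → Ω → ℝ} {η : ι → Ω → ℝ}

lemma posSemidef_covariance {X : Type*} [Fintype X] {k : X → X → ℝ} {p : X → Ω → ℝ}
    (hp : ∀ z, MemLp (p z) 2 P) (hcov : ∀ z z', cov[p z, p z'; P] = k z z') :
    (Matrix.of k).PosSemidef := by
  refine Matrix.PosSemidef.of_dotProduct_mulVec_nonneg ?_ fun c => ?_
  · ext z z'
    simp [← hcov, covariance_comm (p z)]
  · have h := covariance_fun_sum_fun_sum (μ := P) (X := fun z ω => c z * p z ω)
      (Y := fun z ω => c z * p z ω) (fun z => (hp z).const_mul _) fun z => (hp z).const_mul _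
    simp_rw [covariance_const_mul_left, covariance_const_mul_right, hcov] at h
    have hsum : MemLp (fun ω => ∑ z, c z * p z ω) 2 P :=
      memLp_finsetSum _ fun z _ => (hp z).const_mul _
    rw [covariance_self hsum.aemeasurable] at h
    have h0 := variance_nonneg (fun ω => ∑ z, c z * p z ω) P
    rw [h] at h0
    simpa [dotProduct, Matrix.mulVec, Finset.mul_sum, mul_left_comm, mul_comm, mul_assoc] using h0

/-- The error of the posterior mean at `z`. -/
noncomputable def residual (k : X → X → ℝ) (v : ℝ) (p : X → Ω → ℝ) (η : ι → Ω → ℝ) (x : ι → X)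
    (z : X) (ω : Ω) : ℝ :=
  p z ω - postMean k v x (fun j => p (x j) ω + η j ω) z

omit [MeasurableSpace Ω] [Fintype X] in
lemma residual_eq (x : ι → X) (z : X) :
    residual k v p η x z = fun ω => p z ω - ∑ j,
      ((fun j => k z (x j)) ᵥ* (regGram k v x)⁻¹) j * (p (x j) ω + η j ω) := by
  ext ω
  rw [residual, postMean, Matrix.dotProduct_mulVec]
  rfl

/-- The posterior mean is the orthogonal projection of `p z` on the span of the measurements, so the
error is uncorrelated with them, and joint Gaussianity upgrades this to independence. -/
lemma residual_law_and_indep (hp : HasGaussianLaw (fun ω z => p z ω) P)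
    (hmean : ∀ z, ∫ ω, p z ω ∂P = 0) (hcov : ∀ z z', cov[p z, p z'; P] = k z z')
    (hv : 0 < v) (hη_meas : ∀ j, Measurable (η j))
    (hη_law : ∀ j, P.map (η j) = gaussianReal 0 v) (hη_indep : iIndepFun η P)
    (hpη : IndepFun (fun ω z => p z ω) (fun ω j => η j ω) P) (x : ι → X) (z : X) :
    P.map (residual k v p η x z) = gaussianReal 0 (postVar k v x z).toNNReal ∧
      IndepFun (fun ω j => p (x j) ω + η j ω) (residual k v p η x z) P := by
  have hv0 : (0 : ℝ) < v := by exact_mod_cast hv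
  have hpL2 : ∀ z, MemLp (p z) 2 P := fun z => (hp.eval z).memLp_two
  have hηG : ∀ j, HasGaussianLaw (η j) P := fun j => ⟨by rw [hη_law]; infer_instance⟩
  have hηL2 : ∀ j, MemLp (η j) 2 P := fun j => (hηG j).memLp_two
  have hηmean : ∀ j, ∫ ω, η j ω ∂P = 0 := fun j => by
    have h := integral_map (μ := P) (hη_meas j).aemeasurable (f := fun x : ℝ => x)
      aestronglyMeasurable_id
    rw [← h, hη_law, integral_id_gaussianReal]
  have hηcov : ∀ i j, cov[η i, η j; P] = if i = j then (v : ℝ) else 0 := fun i j => by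
    split_ifs with hij
    · subst hij
      rw [covariance_self (hη_meas i).aemeasurable,
        ← variance_id_map (hη_meas i).aemeasurable, hη_law, variance_id_gaussianReal]
    · exact (hη_indep.indepFun hij).covariance_eq_zero (hηL2 i) (hηL2 j)
  have hpηcov : ∀ z j, cov[p z, η j; P] = 0 := fun z j =>
    (hpη.comp (measurable_pi_apply z) (measurable_pi_apply j)).covariance_eq_zero (hpL2 z) (hηL2 j)
  have hk := posSemidef_covariance hpL2 hcov
  have hK := posDef_regGram hk hv0 x
  set w := (fun j => k z (x j)) ᵥ* (regGram k v x)⁻¹ with hw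
  set Y : ι → Ω → ℝ := fun j ω => p (x j) ω + η j ω with hY
  have hYL2 : ∀ j, MemLp (Y j) 2 P := fun j => (hpL2 (x j)).add (hηL2 j)
  have hR : residual k v p η x z = fun ω => p z ω - ∑ j, w j * Y j ω := residual_eq x z
  have hwYL2 : MemLp (fun ω => ∑ j, w j * Y j ω) 2 P :=
    memLp_finsetSum _ fun j _ => (hYL2 j).const_mul _
  have hRL2 : MemLp (residual k v p η x z) 2 P := by
    rw [hR]
    exact (hpL2 z).sub hwYL2
  have hYp : ∀ j z', cov[Y j, p z'; P] = k (x j) z' := fun j z' => by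
    simp only [hY]
    rw [show (fun ω => p (x j) ω + η j ω) = p (x j) + η j from rfl,
      covariance_add_left (hpL2 _) (hηL2 _) (hpL2 _), hcov, covariance_comm, hpηcov, add_zero]
  have hYY : ∀ i j, cov[Y i, Y j; P] = regGram k v x i j := fun i j => by
    have : cov[Y i, η j; P] = if i = j then (v : ℝ) else 0 := by
      simp only [hY]
      rw [show (fun ω => p (x i) ω + η i ω) = p (x i) + η i from rfl,
        covariance_add_left (hpL2 _) (hηL2 _) (hηL2 _), hpηcov, hηcov, zero_add]
    rw [show Y j = p (x j) + η j from rfl,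
      covariance_add_right (hYL2 _) (hpL2 _) (hηL2 _), hYp, this]
    simp [regGram, Matrix.one_apply]
  have hRY : ∀ j, cov[residual k v p η x z, Y j; P] = 0 := fun j => by
    rw [hR, covariance_fun_sub_left (hpL2 z) hwYL2 (hYL2 j),
      covariance_fun_sum_left (fun i => (hYL2 i).const_mul _) (hYL2 j)]
    simp_rw [covariance_const_mul_left, hYY]
    rw [covariance_comm, hYp]
    -- The normal equations of the regression.
    have : w ᵥ* regGram k v x = fun j => k z (x j) := by
      rw [hw, Matrix.vecMul_vecMul, Matrix.nonsing_inv_mul _ ((Matrix.isUnit_iff_isUnit_det _).1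
        hK.isUnit), Matrix.vecMul_one]
    have h2 := congrFun this j
    simp only [Matrix.vecMul, dotProduct] at h2
    rw [h2, kernel_symm hk z, sub_self]
  have hvar : Var[residual k v p η x z; P] = postVar k v x z := by
    rw [← covariance_self hRL2.aemeasurable]
    conv_lhs => enter [2]; rw [hR]
    rw [covariance_fun_sub_right hRL2 (hpL2 z) hwYL2,
      covariance_fun_sum_right (fun i => (hYL2 i).const_mul _) hRL2]
    simp_rw [covariance_const_mul_right, hRY]
    rw [hR, covariance_fun_sub_left (hpL2 z) hwYL2 (hpL2 z),
      covariance_fun_sum_left (fun i => (hYL2 i).const_mul _) (hpL2 z)]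
    simp_rw [covariance_const_mul_left, hYp]
    rw [hcov, postVar, Matrix.dotProduct_mulVec, ← hw]
    simp [dotProduct, kernel_symm hk z]
  have hRmean : ∫ ω, residual k v p η x z ω ∂P = 0 := by
    rw [hR, integral_sub ((hpL2 z).integrable (by simp)) (hwYL2.integrable (by simp)), hmean,
      integral_finsetSum _ fun j _ => ((hYL2 j).integrable (by simp)).const_mul _]
    simp_rw [integral_const_mul, hY]
    simp_rw [integral_add ((hpL2 (x _)).integrable (by simp)) ((hηL2 _).integrable (by simp)),
      hmean, hηmean]
    simp
  have hjoint := hpη.hasGaussianLaw hp (hη_indep.hasGaussianLaw hηG)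
  have hYR : HasGaussianLaw (fun ω => (fun j => Y j ω, fun _ : Unit => residual k v p η x z ω))
      P := by
    have h := hjoint.map_fun (LinearMap.toContinuousLinearMap
      ((LinearMap.pi fun j => LinearMap.proj (R := ℝ) (φ := fun _ : X => ℝ) (x j) ∘ₗ
          LinearMap.fst ℝ (X → ℝ) (ι → ℝ) + LinearMap.proj j ∘ₗ LinearMap.snd ℝ _ _).prod
        (LinearMap.pi fun _ : Unit => LinearMap.proj z ∘ₗ LinearMap.fst ℝ _ _ -
          ∑ j, w j • (LinearMap.proj (R := ℝ) (φ := fun _ : X => ℝ) (x j) ∘ₗ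
          LinearMap.fst ℝ (X → ℝ) (ι → ℝ) + LinearMap.proj j ∘ₗ LinearMap.snd ℝ _ _))))
    refine (congrArg (HasGaussianLaw · P) ?_).mpr h
    ext ω j
    · simp [hY, LinearMap.coe_toContinuousLinearMap']
    · simp [hR, hY, mul_add, LinearMap.coe_toContinuousLinearMap']
  refine ⟨?_, ?_⟩
  · rw [(hYR.snd.eval ()).map_eq_gaussianReal, hRmean, hvar]
  · exact (hYR.indepFun_of_covariance_eval fun j _ => by rw [covariance_comm, hRY]).comp
      measurable_id (measurable_pi_apply ())

end Regression

end SafeOptMC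

/-! ### Confidence bounds under adaptive sampling -/

namespace SafeOptMC

lemma exists_measurableSet_inter_eq {Ω : Type*} {m m' : MeasurableSpace Ω} {s t : Set Ω}
    (h : m.comap (Subtype.val : t → Ω) = m'.comap (Subtype.val : t → Ω))
    (hs : MeasurableSet[m] s) : ∃ s', MeasurableSet[m'] s' ∧ t ∩ s' = t ∩ s := by
  have h1 : MeasurableSet[m.comap (Subtype.val : t → Ω)] (Subtype.val ⁻¹' s) := ⟨s, hs, rfl⟩
  rw [h] at h1
  obtain ⟨s', hs', heq⟩ := h1
  exact ⟨s', hs', Subtype.preimage_val_eq_preimage_val_iff _ _ _ |>.1 heq⟩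

section History

variable {Ω α ι : Type*} {p : α × ι → Ω → ℝ} {noise : ℕ → ι → Ω → ℝ} {a : ℕ → Ω → α}

lemma history_mono {m n : ℕ} (hmn : m ≤ n) : history p noise a m ≤ history p noise a n :=
  iSup_mono fun _ => iSup_mono' fun h => ⟨h.trans_le hmn, le_rfl⟩

lemma comap_history_congr {a' : ℕ → Ω → α} {n : ℕ} {t : Set Ω}
    (h : ∀ ω ∈ t, ∀ m < n, a m ω = a' m ω) :
    (history p noise a n).comap (Subtype.val : t → Ω) =
      (history p noise a' n).comap (Subtype.val : t → Ω) := by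
  simp only [history, MeasurableSpace.comap_iSup, MeasurableSpace.comap_comp]
  refine iSup_congr fun m => iSup_congr fun hm => iSup_congr fun i => ?_
  congr 1
  ext ω
  simp [meas, h ω ω.2 m hm]

/-- On the event that the first `n` evaluated parameters are given, the run of the algorithm is
determined by the measurements at these fixed parameters and by the external randomness. -/
lemma measurableSet_design {𝒰 : MeasurableSpace Ω}
    (ha : ∀ n b, MeasurableSet[𝒰 ⊔ history p noise a n] {ω | a n ω = b}) (b : ℕ → α) (n : ℕ) :
    MeasurableSet[𝒰 ⊔ history p noise (fun m _ => b m) n] {ω | ∀ m < n, a m ω = b m} := by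
  induction n with
  | zero => simp
  | succ n ih =>
    set t : Set Ω := {ω | ∀ m < n, a m ω = b m} with ht
    -- On `t` the adaptive and the fixed design agree, so both histories have the same trace there,
    -- and the next decision can be read off the fixed one.
    have hcomap : (𝒰 ⊔ history p noise a n).comap (Subtype.val : t → Ω) =
        (𝒰 ⊔ history p noise (fun m _ => b m) n).comap (Subtype.val : t → Ω) := by
      rw [MeasurableSpace.comap_sup, MeasurableSpace.comap_sup,
        comap_history_congr (t := t) (a' := fun m _ => b m) fun ω hω => hω]
    obtain ⟨s, hs, heq⟩ := exists_measurableSet_inter_eq hcomap (ha n (b n))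
    have hset : {ω | ∀ m < n + 1, a m ω = b m} = t ∩ s := by
      rw [heq]
      ext ω
      simp only [ht, Set.mem_ofPred_eq, Set.mem_inter_iff]
      refine ⟨fun h => ⟨fun m hm => h m (by omega), h n (by omega)⟩, fun h m hm => ?_⟩
      rcases Nat.lt_succ_iff_lt_or_eq.1 hm with hm | rfl
      · exact h.1 m hm
      · exact h.2
    rw [hset]
    exact sup_le_sup_left (history_mono n.le_succ) _ _ (MeasurableSet.inter ih hs)

lemma history_const_le (b : ℕ → α) (n : ℕ) :
    history p noise (fun m _ => b m) n ≤ MeasurableSpace.comap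
      (fun ω (j : Fin n × ι) => p (b j.1, j.2) ω + noise j.1 j.2 ω) inferInstance := by
  refine iSup_le fun m => iSup_le fun hm => iSup_le fun i => ?_
  rintro _ ⟨s, hs, rfl⟩
  exact ⟨(fun f : Fin n × ι → ℝ => f (⟨m, hm⟩, i)) ⁻¹' s, measurable_pi_apply _ hs, rfl⟩

end History

section Confidence

variable {Ω : Type*} {𝒰 : MeasurableSpace Ω} [mΩ : MeasurableSpace Ω] {P : Measure Ω}
  [IsProbabilityMeasure P] {α ι : Type*} [Fintype α] [Fintype ι] [DecidableEq ι]
  {k : α × ι → α × ι → ℝ} {v : ℝ≥0} {p : α × ι → Ω → ℝ} {noise : ℕ → ι → Ω → ℝ}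
  {a : ℕ → Ω → α}

/-- Validity of a Gaussian confidence interval under adaptive sampling. -/
lemma measure_confidence_compl_le [Nonempty α] (hv : 0 < v) (hp_meas : ∀ z, Measurable (p z))
    (hp_gauss : HasGaussianLaw (fun ω z => p z ω) P) (hp_mean : ∀ z, ∫ ω, p z ω ∂P = 0)
    (hp_cov : ∀ z z', cov[p z, p z'; P] = k z z')
    (hn_meas : ∀ m i, Measurable (noise m i))
    (hn_law : ∀ m i, P.map (noise m i) = gaussianReal 0 v)
    (hn_indep : iIndepFun (fun mi : ℕ × ι => noise mi.1 mi.2) P)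
    (hpn_indep : IndepFun (fun ω z => p z ω) (fun ω (mi : ℕ × ι) => noise mi.1 mi.2 ω) P)
    (h𝒰 : 𝒰 ≤ mΩ)
    (h𝒰_indep : Indep 𝒰 (MeasurableSpace.comap
      (fun ω => ((fun z => p z ω), fun mi : ℕ × ι => noise mi.1 mi.2 ω)) inferInstance) P)
    (ha : ∀ n b, MeasurableSet[𝒰 ⊔ history p noise a n] {ω | a n ω = b})
    (n : ℕ) (z : α × ι) {c : ℝ} (hc : 0 ≤ c) :
    P {ω | c * √(postVar k v (fun j : Fin n × ι => (a j.1 ω, j.2)) z) <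
      |p z ω - postMean k v (fun j : Fin n × ι => (a j.1 ω, j.2))
        (fun j => meas p noise a ω j.1 j.2) z|} ≤ ENNReal.ofReal (Real.exp (-c ^ 2 / 2)) := by
  classical
  have hv0 : (0 : ℝ) < v := by exact_mod_cast hv
  have hk := posSemidef_covariance (fun z => (hp_gauss.eval z).memLp_two) hp_cov
  set bad := {ω | c * √(postVar k v (fun j : Fin n × ι => (a j.1 ω, j.2)) z) <
      |p z ω - postMean k v (fun j : Fin n × ι => (a j.1 ω, j.2))
        (fun j => meas p noise a ω j.1 j.2) z|} with hbad
  -- Values beyond the first `n` are never inspected, so any default will do.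
  set ext : (Fin n → α) → ℕ → α := fun b m => if h : m < n then b ⟨m, h⟩ else
    Classical.arbitrary α with hext
  set D : (Fin n → α) → Set Ω := fun b => {ω | ∀ m < n, a m ω = ext b m} with hD
  have hext_apply : ∀ b (j : Fin n), ext b j = b j := fun b j => by simp [hext]
  set η : Fin n × ι → Ω → ℝ := fun j => noise j.1 j.2 with hη
  have hηm : ∀ j, Measurable (η j) := fun j => hn_meas _ _
  have hjm : Measurable fun ω => ((fun z => p z ω), fun mi : ℕ × ι => noise mi.1 mi.2 ω) :=
    (measurable_pi_iff.2 hp_meas).prodMk (measurable_pi_iff.2 fun mi => hn_meas _ _)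
  have hinj : Function.Injective fun j : Fin n × ι => ((j.1 : ℕ), j.2) := fun j j' h => by
    simp only [Prod.mk.injEq] at h
    exact Prod.ext (Fin.ext h.1) h.2
  have key : ∀ b, MeasurableSet (D b) ∧
      P (bad ∩ D b) ≤ ENNReal.ofReal (Real.exp (-c ^ 2 / 2)) * P (D b) := fun b => by
    set x : Fin n × ι → α × ι := fun j => (b j.1, j.2) with hx
    set Y : Ω → Fin n × ι → ℝ := fun ω j => p (x j) ω + η j ω with hY
    set R := residual k v p η x z with hR
    obtain ⟨hlaw, hind⟩ := residual_law_and_indep hp_gauss hp_mean hp_cov hv hηm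
      (fun j => hn_law _ _) (hn_indep.precomp hinj)
      (hpn_indep.comp measurable_id (ψ := fun (f : ℕ × ι → ℝ) (j : Fin n × ι) => f (j.1, j.2))
        (measurable_pi_iff.2 fun j => measurable_pi_apply _)) x z
    have hYm : Measurable Y := measurable_pi_iff.2 fun j => (hp_meas _).add (hηm j)
    have hYj : Measurable[MeasurableSpace.comap
        (fun ω => ((fun z => p z ω), fun mi : ℕ × ι => noise mi.1 mi.2 ω)) inferInstance] Y := by
      refine (Measurable.comp (g := fun f : (α × ι → ℝ) × (ℕ × ι → ℝ) =>
        fun j : Fin n × ι => f.1 (x j) + f.2 (j.1, j.2)) ?_ (comap_measurable _))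
      fun_prop
    have hRj : Measurable[MeasurableSpace.comap
        (fun ω => ((fun z => p z ω), fun mi : ℕ × ι => noise mi.1 mi.2 ω)) inferInstance] R := by
      have h : R = (fun f : (α × ι → ℝ) × (ℕ × ι → ℝ) => f.1 z - ∑ j : Fin n × ι,
          ((fun j => k z (x j)) ᵥ* (regGram k v x)⁻¹) j * (f.1 (x j) + f.2 (j.1, j.2))) ∘
          fun ω => ((fun z => p z ω), fun mi : ℕ × ι => noise mi.1 mi.2 ω) := residual_eq x z
      rw [h]
      refine Measurable.comp ?_ (comap_measurable _)
      fun_prop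
    have hRm : Measurable R := hRj.mono hjm.comap_le le_rfl
    -- Everything that determines the design is independent of the regression error.
    have hI : Indep (𝒰 ⊔ MeasurableSpace.comap Y inferInstance)
        (MeasurableSpace.comap R inferInstance) P :=
      indep_sup_of_indep h𝒰 hYm.comap_le hRm.comap_le
        (indep_of_indep_of_le_right h𝒰_indep (sup_le hYj.comap_le hRj.comap_le)) hind
    have hDm : MeasurableSet[𝒰 ⊔ MeasurableSpace.comap Y inferInstance] (D b) := by
      have h := sup_le_sup_left (history_const_le (p := p) (noise := noise) (ext b) n) 𝒰 _
        (measurableSet_design ha (ext b) n)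
      have hYeq : Y = fun ω (j : Fin n × ι) => p (ext b j.1, j.2) ω + noise j.1 j.2 ω := by
        simp only [hY, hx, hη, hext_apply]
      rwa [hYeq]
    refine ⟨sup_le h𝒰 hYm.comap_le _ hDm, ?_⟩
    set B : Set ℝ := {r | c * √((postVar k v x z).toNNReal : ℝ) < |r|} with hB
    have hBm : MeasurableSet B := measurableSet_lt measurable_const continuous_abs.measurable
    have hsub : bad ∩ D b ⊆ D b ∩ R ⁻¹' B := by
      rintro ω ⟨h1, h2⟩
      refine ⟨h2, ?_⟩
      have ha' : ∀ j : Fin n, a j ω = b j := fun j => (h2 j j.2).trans (hext_apply b j)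
      simp only [hbad, Set.mem_ofPred_eq, meas, ha'] at h1
      simpa [hB, hR, residual, hx, hη, max_eq_left (postVar_nonneg hk hv0 (fun j : Fin n × ι => (b j.1, j.2)) z)] using h1
    refine (measure_mono hsub).trans ?_
    rw [(Indep_iff _ _ _).1 hI _ _ hDm ⟨B, hBm, rfl⟩, mul_comm, ← Measure.map_apply hRm hBm, hlaw]
    gcongr
    exact gaussianReal_abs_gt_le _ hc
  have hcover : bad ⊆ ⋃ b, bad ∩ D b := fun ω hω =>
    Set.mem_iUnion.2 ⟨fun j => a j ω, hω, fun m hm => by simp [hext, hm]⟩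
  have hdisj : Pairwise (Function.onFun Disjoint D) := fun b b' hbb' =>
    Set.disjoint_left.2 fun ω h1 h2 => hbb' <| funext fun j => by
      rw [← hext_apply b, ← hext_apply b', ← h1 j j.2, ← h2 j j.2]
  calc P bad ≤ ∑ b, P (bad ∩ D b) := (measure_mono hcover).trans (measure_iUnion_fintype_le _ _)
    _ ≤ ∑ b, ENNReal.ofReal (Real.exp (-c ^ 2 / 2)) * P (D b) :=
        Finset.sum_le_sum fun b _ => (key b).2
    _ = ENNReal.ofReal (Real.exp (-c ^ 2 / 2)) * P (⋃ b, D b) := by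
        rw [← Finset.mul_sum, measure_iUnion hdisj fun b => (key b).1, tsum_fintype]
    _ ≤ _ := by
        conv_rhs => rw [← mul_one (ENNReal.ofReal _)]
        gcongr
        exact prob_le_one

end Confidence

end SafeOptMC

/-! ### Union bound and conclusion -/

namespace SafeOptMC

lemma hasGaussianLaw_of_isGaussianProcess {Ω X : Type*} [MeasurableSpace Ω] [Fintype X]
    {P : Measure Ω} {p : X → Ω → ℝ} (hp : IsGaussianProcess p P) :
    HasGaussianLaw (fun ω z => p z ω) P :=
  (hp.hasGaussianLaw Finset.univ).map_fun (ContinuousLinearMap.pi fun z : X =>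
    ContinuousLinearMap.proj (R := ℝ) (φ := fun _ : (Finset.univ : Finset X) => ℝ)
      ⟨z, Finset.mem_univ z⟩)

lemma exp_neg_sqrt_sq_div_two {c δ r : ℝ} (hc : 0 < c) (hδ : 0 < δ) (hr : 0 < r)
    (hβ : 0 ≤ 2 * Real.log (c * r / δ)) :
    Real.exp (-√(2 * Real.log (c * r / δ)) ^ 2 / 2) = δ / c * r⁻¹ := by
  rw [Real.sq_sqrt hβ, neg_div, mul_div_cancel_left₀ _ (by norm_num), Real.exp_neg,
    Real.exp_log (by positivity)]
  field_simp

/-- Union bound over countably many finite families of events. -/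
lemma measure_iUnion_iUnion_le_ofReal {Ω κ : Type*} [MeasurableSpace Ω] {P : Measure Ω}
    [Fintype κ] [Nonempty κ] {B : ℕ → κ → Set Ω} {δ : ℝ} {r : ℕ → ℝ} (hδ : 0 < δ)
    (hr : ∀ n, 0 ≤ r n) (hsum : HasSum r 1)
    (hB : ∀ n z, P (B n z) ≤ ENNReal.ofReal (δ / Fintype.card κ * r n)) :
    P (⋃ n, ⋃ z, B n z) ≤ ENNReal.ofReal δ := by
  have hc : (0 : ℝ) < Fintype.card κ := by exact_mod_cast Fintype.card_pos
  calc P (⋃ n, ⋃ z, B n z) ≤ ∑' n, P (⋃ z, B n z) := measure_iUnion_le _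
    _ ≤ ∑' n, ENNReal.ofReal (δ * r n) := by
        refine ENNReal.tsum_le_tsum fun n => ?_
        refine (measure_iUnion_fintype_le _ _).trans ((Finset.sum_le_sum fun z _ => hB n z).trans ?_)
        rw [Finset.sum_const, Finset.card_univ, nsmul_eq_mul, ← ENNReal.ofReal_natCast,
          ← ENNReal.ofReal_mul hc.le]
        apply le_of_eq
        congr 1
        field_simp
    _ = ENNReal.ofReal (∑' n, δ * r n) :=
        (ENNReal.ofReal_tsum_of_nonneg (fun n => mul_nonneg hδ.le (hr n))
          (hsum.mul_left δ).summable).symm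
    _ = ENNReal.ofReal δ := by rw [(hsum.mul_left δ).tsum_eq, mul_one]

lemma ofReal_one_sub_le_compl_toMeasurable {Ω : Type*} [MeasurableSpace Ω] {P : Measure Ω}
    [IsProbabilityMeasure P] {s : Set Ω} {δ : ℝ} (hδ : 0 ≤ δ) (hs : P s ≤ ENNReal.ofReal δ) :
    ENNReal.ofReal (1 - δ) ≤ P (toMeasurable P s)ᶜ := by
  rw [prob_compl_eq_one_sub (measurableSet_toMeasurable P s), measure_toMeasurable,
    ENNReal.ofReal_sub _ hδ, ENNReal.ofReal_one]
  exact tsub_le_tsub_left hs 1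

end SafeOptMC

theorem theorem1
    {Ω : Type*} (𝒰 : MeasurableSpace Ω) [mΩ : MeasurableSpace Ω] (P : Measure Ω) [IsProbabilityMeasure P]
    {E : Type*} [NormedAddCommGroup E] [NormedSpace ℝ E] (A : Finset E) (q : ℕ)
    (I : SafeOptMC.Input A q)
    -- admissible inputs of the algorithm
    (hv : 0 < I.v)
    (hS₀ : I.S₀.Nonempty)
    (hJ : ∀ i : Fin (q + 1), i ≠ 0 → i ∈ I.J)
    (hθ : I.θ ≤ 1)
    -- choice of the confidence parameters
    (δ : ℝ) (hδ₀ : 0 < δ) (hδ₁ : δ < 1)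
    (π : ℕ → ℝ) (hπ_pos : ∀ n, 1 ≤ n → 0 < π n)
    (hπ_sum : HasSum (fun n : ℕ => (π (n + 1))⁻¹) 1)
    (hβ : ∀ n, 1 ≤ n → I.β n = 2 * Real.log (((q + 1 : ℕ) : ℝ) * (A.card : ℝ) * π n / δ))
    -- the surrogate function is a zero-mean Gaussian process with kernel `k`
    (p : A × Fin (q + 1) → Ω → ℝ)
    (hp_meas : ∀ z, Measurable (p z))
    (hp_gauss : IsGaussianProcess p P)
    (hp_mean : ∀ z, ∫ ω, p z ω ∂P = 0)
    (hp_cov : ∀ z z', covariance (p z) (p z') P = I.k z z')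
    -- independent Gaussian measurement noise
    (noise : ℕ → Fin (q + 1) → Ω → ℝ)
    (hn_meas : ∀ m i, Measurable (noise m i))
    (hn_law : ∀ m i, P.map (noise m i) = gaussianReal 0 I.v)
    (hn_indep : iIndepFun (fun mi : ℕ × Fin (q + 1) => noise mi.1 mi.2) P)
    (hpn_indep : IndepFun (fun ω z => p z ω) (fun ω (mi : ℕ × Fin (q + 1)) => noise mi.1 mi.2 ω) P)
    -- a run of the algorithm; ties are broken using past measurements and independent randomness `𝒰`
    (h𝒰 : 𝒰 ≤ mΩ)
    (h𝒰_indep : Indep 𝒰 (MeasurableSpace.comap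
      (fun ω => ((fun z => p z ω), fun mi : ℕ × Fin (q + 1) => noise mi.1 mi.2 ω))
      inferInstance) P)
    (a : ℕ → Ω → A)
    (ha_meas : ∀ n b, MeasurableSet[𝒰 ⊔ SafeOptMC.history p noise a n] {ω | a n ω = b})
    (ha : ∀ n ω,
      (I.G (fun m => a m ω) (SafeOptMC.meas p noise a ω) (n + 1) ∪
        I.M (fun m => a m ω) (SafeOptMC.meas p noise a ω) (n + 1)).Nonempty →
      a n ω ∈ I.acquisition (fun m => a m ω) (SafeOptMC.meas p noise a ω) (n + 1))
    -- the pessimistic estimates of the best parameters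
    (ahat : ℕ → Ω → A)
    (hahat : ∀ n ω, 1 ≤ n →
      (I.S (fun m => a m ω) (SafeOptMC.meas p noise a ω) n).Nonempty →
      ahat n ω ∈ I.bestEstimates (fun m => a m ω) (SafeOptMC.meas p noise a ω) n)
    -- the accuracy
    (ε : ℝ) (hε : 0 ≤ ε) :
    ∃ F : Set Ω, MeasurableSet F ∧ ENNReal.ofReal (1 - δ) ≤ P F ∧ ∀ ω ∈ F,
      (∀ i, ∀ b c : A, |p (b, i) ω - p (c, i) ω| ≤ I.L * ‖(b : E) - (c : E)‖) →
      (∀ i ∈ I.J, ∀ b ∈ I.S₀, 0 ≤ p (b, i) ω) →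
      (∀ n, ∀ i : Fin (q + 1), i ≠ 0 → 0 ≤ p (a n ω, i) ω) ∧
      ((∀ z, I.k z z ≤ 1) → (∀ m n, 1 ≤ m → m ≤ n → π m ≤ π n) →
        ∀ nstar : ℕ,
          IsLeast {n : ℕ | 0 < n ∧
            ENNReal.ofReal (8 / Real.log (1 + (I.v : ℝ)⁻¹) *
                (((SafeOptMC.reachLim I.L (fun z => p z ω) 0 I.S₀).ncard : ℝ) + 1)) /
              ENNReal.ofReal (ε ^ 2) ≤
            (n : ℝ≥0∞) / (ENNReal.ofReal (I.β n) *
              SafeOptMC.infoGain (P.map fun ω' z => p z ω') I.v ((q + 1) * n))} nstar →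
          ∀ n, nstar ≤ n →
            SafeOptMC.fStar I.L (fun z => p z ω) ε I.S₀ - ε ≤ p (ahat n ω, 0) ω) := by
  classical
  have hA : Nonempty A := ⟨hS₀.some⟩
  have hAc : (0 : ℝ) < (A.card : ℝ) := by exact_mod_cast Finset.card_pos.2 ⟨_, hA.some.2⟩
  -- Each reciprocal is at most the total sum 1; this makes every `β n` positive.
  have hπ_one : ∀ n, 1 ≤ n → 1 ≤ π n := fun n hn => by
    obtain ⟨m, rfl⟩ := Nat.exists_eq_add_of_le' hn
    have h := le_hasSum hπ_sum m fun j _ => (inv_pos.2 (hπ_pos (j + 1) (by omega))).le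
    exact (inv_le_one₀ (hπ_pos _ hn)).1 h
  have hβ_arg : ∀ n, 1 ≤ n → 1 < ((q + 1 : ℕ) : ℝ) * (A.card : ℝ) * π n / δ := fun n hn => by
    have h1 : (1 : ℝ) ≤ ((q + 1 : ℕ) : ℝ) := by exact_mod_cast Nat.succ_le_succ (Nat.zero_le q)
    have h2 : (1 : ℝ) ≤ (A.card : ℝ) := by exact_mod_cast Nat.cast_pos.1 hAc
    rw [one_lt_div hδ₀]
    exact hδ₁.trans_le (one_le_mul_of_one_le_of_one_le (one_le_mul_of_one_le_of_one_le h1 h2)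
      (hπ_one n hn))
  have hβ_pos : ∀ n, 1 ≤ n → 0 < I.β n := fun n hn => by
    rw [hβ n hn]
    exact mul_pos two_pos (Real.log_pos (hβ_arg n hn))
  have hgauss : HasGaussianLaw (fun ω z => p z ω) P :=
    SafeOptMC.hasGaussianLaw_of_isGaussianProcess hp_gauss
  set B : ℕ → A × Fin (q + 1) → Set Ω := fun n z =>
    {ω | √(I.β (n + 1)) * I.σ (fun m => a m ω) n z <
      |p z ω - I.μ (fun m => a m ω) (SafeOptMC.meas p noise a ω) n z|} with hB
  have hbad : P (⋃ n, ⋃ z, B n z) ≤ ENNReal.ofReal δ := by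
    refine SafeOptMC.measure_iUnion_iUnion_le_ofReal hδ₀
      (fun n => (inv_pos.2 (hπ_pos (n + 1) (by omega))).le) hπ_sum fun n z => ?_
    refine (SafeOptMC.measure_confidence_compl_le hv hp_meas hgauss hp_mean hp_cov hn_meas hn_law
      hn_indep hpn_indep h𝒰 h𝒰_indep ha_meas n z (Real.sqrt_nonneg (I.β (n + 1)))).trans ?_
    have h := (hβ_pos (n + 1) (by omega)).le
    rw [hβ (n + 1) (by omega)] at h ⊢
    rw [SafeOptMC.exp_neg_sqrt_sq_div_two (by positivity) hδ₀ (hπ_pos _ (by omega)) h]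
    simp [mul_comm]
  have hk := SafeOptMC.posSemidef_covariance (fun z => (hgauss.eval z).memLp_two) hp_cov
  have hpm : Measurable fun ω z => p z ω := measurable_pi_iff.2 hp_meas
  have hν : IsGaussian (P.map fun ω z => p z ω) := hgauss.isGaussian_map
  have hν_mean : ∀ z, ∫ f, f z ∂(P.map fun ω z => p z ω) = 0 := fun z => by
    rw [integral_map hpm.aemeasurable (measurable_pi_apply z).aestronglyMeasurable, hp_mean]
  have hν_cov : ∀ z z', cov[fun f => f z, fun f => f z'; P.map fun ω z => p z ω] = I.k z z' :=
    fun z z' => by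
      rw [covariance_map_fun (measurable_pi_apply z).aestronglyMeasurable
        (measurable_pi_apply z').aestronglyMeasurable hpm.aemeasurable, hp_cov]
  -- A measurable hull of the bad event has the same measure, so measurability of the bad event
  -- itself need not be checked.
  refine ⟨(toMeasurable P (⋃ n, ⋃ z, B n z))ᶜ, (measurableSet_toMeasurable _ _).compl,
    SafeOptMC.ofReal_one_sub_le_compl_toMeasurable hδ₀.le hbad, fun ω hω hlip hinit => ?_⟩
  have hωB : ∀ n z, ω ∉ B n z := fun n z h =>
    hω (subset_toMeasurable _ _ (Set.mem_iUnion.2 ⟨n, Set.mem_iUnion.2 ⟨z, h⟩⟩))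
  have hcal : I.WellCalibrated (fun m => a m ω) (SafeOptMC.meas p noise a ω)
      (fun z => p z ω) := ⟨fun n z => not_lt.1 (hωB n z), hinit, hJ⟩
  -- Calibration makes the set of maximizers nonempty, so the acquisition rule applies. The
  -- parameter `a n` belongs to iteration `n + 1`.
  have hacq := fun n => ha n ω ((hcal.M_nonempty hS₀ (Nat.le_add_left 1 n)).mono
    Set.subset_union_right)
  refine ⟨fun n i hi => ?_, fun hk1 hπ_mono nstar hstar n hn => ?_⟩
  · have hS : a n ω ∈ I.S (fun m => a m ω) (SafeOptMC.meas p noise a ω) (n + 1) :=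
      (hacq n).1.elim (fun h => h.1) fun h => h.1
    exact hcal.nonneg_of_mem_S hlip hS hi
  · have hn1 : 1 ≤ n := hstar.1.1.trans_le hn
    refine hcal.fStar_sub_le_of_threshold hk hv hS₀ hθ hε hk1 hβ_pos (fun m n hm hmn => ?_) hacq
      hstar.1.1 (fun b i => ?_) hstar.1.2 hn (hahat n ω hn1 (hcal.S_nonempty hS₀ n))
    · rw [hβ m hm, hβ n (hm.trans hmn)]
      have h0 := hπ_pos m hm
      have h1 := hπ_mono m n hm hmn
      gcongr
    · exact SafeOptMC.sum_log_le_infoGain _ hk hν_mean hν_cov hv b i nstar
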